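/- **Proposition 4.2.** Let $\beta\in(0,1)$ and let $f_0:[0,1]\to\mathbb R$ satisfy - (H1) $f_0(r)=\tilde f_0(r^2)$ for $r\in[0,1]$, with $\tilde f_0\in\mathscr C^{2,\beta}([0,1])$; - (H2) $\inf_{r\in(0,1]}\frac{f_0'(r)}{r}>0$. Put $$\kappa_1=\inf_{r\in[0,1]}\int_0^1 s f_0(rs)\,ds,\qquad \kappa_2=\sup_{r\in[0,1]}\int_0^1 s f_0(rs)\,ds,$$ and for $\Omega\notin[\kappa_1,\kappa_2]$ and $r\in[0,1]$ $$\mu_\Omega^0(r)=\frac{f_0'(r)}{r\left(\Omega-\int_0^1 sf_0(rs)\,ds\right)},\qquad \nu_\Omega(r)=|\mu^0_\Omega(r)|,\qquad d\lambda_\Omega(s)=\frac{s}{\nu_\Omega(s)}\,ds \ \text{ on } [0,1],$$ where $f_0'(r)/r$ is extended to $r=0$ by its limit. Let $L^2_\Omega=L^2(\lambda_\Omega)$ be the real Hilbert space of (classes of) $\lambda_\Omega$-square-integrable functions on $[0,1]$, and for $h\in L^2_\Omega$ set $$\mathcal L_0^\Omega[h](r)=\nu_\Omega(r)\int_r^1\frac1\tau\int_0^\tau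 s\,h(s)\,ds\,d\tau,\qquad \mathbb L_0^\Omega[h](r)=\frac{h(r)}{\mu^0_\Omega(r)}-\int_r^1\frac1\tau\int_0^\tau s\,h(s)\,ds\,d\tau .$$ Then: 1. For every $\Omega\notin[\kappa_1,\kappa_2]$, the integrals above converge absolutely for every $h\in L^2_\Omega$, and $\mathcal L_0^\Omega$ is a bounded, self-adjoint, positive-definite (i.e. $\langle\mathcal L_0^\Omega h,h\rangle_{L^2_\Omega}>0$ for all $h\neq0$), compact and Hilbert–Schmidt operator from $L^2_\Omega$ to $L^2_\Omega$. 2. If $\Omega<\kappa_1$, then the kernel of $\mathbb L_0^\Omega$ in $L^2_\Omega$ is $\{0\}$. 3. There is a finite set $\mathbb S\subset(\kappa_2,\infty)$ such that, for every $\Omega\in(\kappa_2,\infty)\setminus\mathbb S$, the kernel of $\mathbb L_0^\Omega$ in $L^2_\Omega$ is $\{0\}$. -/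

import Mathlib

open MeasureTheory Set
open scoped NNReal ENNReal

noncomputable section

namespace RadialVortex

/-- The Hölder space `C^{2,β}([0,1])`: twice continuously differentiable up to the boundary, with a
`β`-Hölder second derivative. -/
def HolderC2 (β : ℝ≥0) (g : ℝ → ℝ) : Prop :=
  ContDiffOn ℝ 2 g (Icc 0 1) ∧
    ∃ C : ℝ≥0, HolderOnWith C β (iteratedDerivWithin 2 g (Icc 0 1)) (Icc 0 1)

/-- The derivative `f₀'` on `[0,1]` (one-sided at the end points). Only the values of `f₀` on
`[0,1]` matter. -/
def profileDeriv (f₀ : ℝ → ℝ) (r : ℝ) : ℝ :=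
  derivWithin f₀ (Icc 0 1) r

/-- Smoothness of the profile: `f₀(r) = f̃₀(r²)` on `[0,1]`, with `f̃₀ ∈ C^{2,β}([0,1])`. -/
def SmoothProfile (β : ℝ≥0) (f₀ : ℝ → ℝ) : Prop :=
  ∃ g : ℝ → ℝ, HolderC2 β g ∧ ∀ r ∈ Icc (0 : ℝ) 1, f₀ r = g (r ^ 2)

/-- Strict monotonicity of the profile: `inf_{r ∈ (0,1]} f₀'(r)/r > 0`. -/
def MonotoneProfile (f₀ : ℝ → ℝ) : Prop :=
  0 < sInf ((fun r => profileDeriv f₀ r / r) '' Ioc 0 1)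

/-- The function `r ↦ ∫₀¹ s f₀(rs) ds`. -/
def meanProfile (f₀ : ℝ → ℝ) (r : ℝ) : ℝ :=
  ∫ s in (0 : ℝ)..1, s * f₀ (r * s)

/-- `κ₁ = inf_{r ∈ [0,1]} ∫₀¹ s f₀(rs) ds`. -/
def kappa₁ (f₀ : ℝ → ℝ) : ℝ := sInf (meanProfile f₀ '' Icc 0 1)

/-- `κ₂ = sup_{r ∈ [0,1]} ∫₀¹ s f₀(rs) ds`. -/
def kappa₂ (f₀ : ℝ → ℝ) : ℝ := sSup (meanProfile f₀ '' Icc 0 1)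

/-- The function `r ↦ f₀'(r)/r`, extended to `r = 0` by its limit `f₀''(0)`. -/
def derivOverR (f₀ : ℝ → ℝ) (r : ℝ) : ℝ :=
  if r = 0 then derivWithin (profileDeriv f₀) (Icc 0 1) 0 else profileDeriv f₀ r / r

/-- `μ_Ω⁰(r) = f₀'(r) / (r (Ω - ∫₀¹ s f₀(rs) ds))`. -/
def mu (f₀ : ℝ → ℝ) (Ω r : ℝ) : ℝ :=
  derivOverR f₀ r / (Ω - meanProfile f₀ r)

/-- `ν_Ω = |μ_Ω⁰|`. -/
def nu (f₀ : ℝ → ℝ) (Ω r : ℝ) : ℝ := |mu f₀ Ω r|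

/-- The measure `dλ_Ω(s) = s / ν_Ω(s) ds` on `[0,1]`. -/
def lam (f₀ : ℝ → ℝ) (Ω : ℝ) : Measure ℝ :=
  (volume.restrict (Icc 0 1)).withDensity fun s => ENNReal.ofReal (s / nu f₀ Ω s)

/-- The real Hilbert space `L²_Ω = L²(λ_Ω)`. -/
abbrev L2 (f₀ : ℝ → ℝ) (Ω : ℝ) : Type := Lp ℝ 2 (lam f₀ Ω)

/-- `τ ↦ (1/τ) ∫₀^τ s h(s) ds`. -/
def radialAverage (h : ℝ → ℝ) (τ : ℝ) : ℝ :=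
  1 / τ * ∫ s in (0 : ℝ)..τ, s * h s

/-- `r ↦ ∫_r^1 (1/τ) ∫₀^τ s h(s) ds dτ`. -/
def radialPotential (h : ℝ → ℝ) (r : ℝ) : ℝ :=
  ∫ τ in r..1, radialAverage h τ

/-- `𝓛_0^Ω[h](r) = ν_Ω(r) ∫_r^1 (1/τ) ∫₀^τ s h(s) ds dτ`. -/
def calL₀ (f₀ : ℝ → ℝ) (Ω : ℝ) (h : ℝ → ℝ) (r : ℝ) : ℝ :=
  nu f₀ Ω r * radialPotential h r

/-- `𝕃_0^Ω[h](r) = h(r) / μ_Ω⁰(r) - ∫_r^1 (1/τ) ∫₀^τ s h(s) ds dτ`. -/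
def bbL₀ (f₀ : ℝ → ℝ) (Ω : ℝ) (h : ℝ → ℝ) (r : ℝ) : ℝ :=
  h r / mu f₀ Ω r - radialPotential h r

/-- The kernel of `𝕃_0^Ω` in `L²_Ω`. -/
def kerL₀ (f₀ : ℝ → ℝ) (Ω : ℝ) : Set (L2 f₀ Ω) :=
  {h | bbL₀ f₀ Ω h =ᵐ[lam f₀ Ω] 0}

/-- A bounded operator is Hilbert–Schmidt if `∑ᵢ ‖T eᵢ‖² < ∞` for every Hilbert basis `(eᵢ)`. -/
def IsHilbertSchmidt {E : Type*} [NormedAddCommGroup E] [InnerProductSpace ℝ E]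
    (T : E →L[ℝ] E) : Prop :=
  ∀ (s : Set E) (b : HilbertBasis s ℝ E), Summable fun i => ‖T (b i)‖ ^ 2

end RadialVortex

end

open RadialVortex

open MeasureTheory Set
open scoped NNReal ENNReal

noncomputable section

/-! Let `K` be the radial potential and `S h(τ) = τ^{-1/2} ∫₀^τ s h(s) ds`, viewed as a map from
`L²(s/v ds)` to `L²(0,1)`. Fubini over the triangle `s < τ` gives `⟨S h, S k⟩ = ∫ s k(s) K h(s) ds`.
For a bounded weight `v` this says `S* S = v K` (`potentialOp_eq`), so self-adjointness is automatic
and positivity is injectivity of `S`. For fixed `τ`, the functional `h ↦ ∫₀^τ s h` is represented by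
the truncation of `v` to `(0,τ)`. Bessel's inequality there, integrated in `τ`, bounds the squared
Hilbert–Schmidt norm of `S` (`hilbertSchmidtSqLE_halfOp`), which gives compactness. The bound
survives a simple pole of `v` at `1`, because `log (1 - τ)` is integrable.

If `Ω < κ₁`, then `μ = -ν`, and a kernel element would be an eigenvector of the positive operator `ν
K` for the eigenvalue `-1`.

If `Ω > κ₂`, write `w = f₀'(r)/r`. Then `1/μ_Ω = (Ω - κ₂)/w + 1/μ_{κ₂}`, and a kernel element `h`
satisfies `⟨S h, S k⟩ = (Ω - κ₂)⟨h, k⟩_w + ⟨h, k⟩_{μ_{κ₂}}` in spaces that do not depend on `Ω`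
(`inner_halfOp_of_mem_kerL₀`). By symmetry, kernel elements for distinct `Ω` are `w`-orthogonal, so
`‖S x‖² - ‖x‖²` is diagonal and positive on their span. Hence their number is at most the squared
Hilbert–Schmidt norm of `S` at the threshold weight `μ_{κ₂}` (`HilbertSchmidtSqLE.card_le`). That
norm is finite, since monotonicity of `f₀` makes the pole at `1` at most simple
(`kappa₂_sub_meanProfile_ge`). -/

namespace RadialVortex

/-! ### Hilbert–Schmidt bounds, compactness and counting -/

section HilbertSchmidt

variable {E F : Type*} [NormedAddCommGroup E] [InnerProductSpace ℝ E]
  [NormedAddCommGroup F] [InnerProductSpace ℝ F]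

/-- The squared Hilbert–Schmidt norm of `S` is at most `M`: the sums `∑ᵢ ‖S eᵢ‖²` over finite
orthonormal families are bounded by `M`. -/
def HilbertSchmidtSqLE (S : E →L[ℝ] F) (M : ℝ) : Prop :=
  ∀ (n : ℕ) (e : Fin n → E), Orthonormal ℝ e → ∑ i, ‖S (e i)‖ ^ 2 ≤ M

lemma isCompactOperator_of_finiteDimensional [FiniteDimensional ℝ E] (S : E →L[ℝ] F) :
    IsCompactOperator S := by
  have h := (isCompactOperator_id_iff_finiteDimensional (𝕜 := ℝ) (E := E)).2 inferInstance
  exact h.clm_comp S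

lemma HilbertSchmidtSqLE.sum_le {S : E →L[ℝ] F} {M : ℝ} (h : HilbertSchmidtSqLE S M)
    {ι : Type*} {e : ι → E} (he : Orthonormal ℝ e) (s : Finset ι) :
    ∑ i ∈ s, ‖S (e i)‖ ^ 2 ≤ M := by
  have h1 := h s.card (fun j => e (s.equivFin.symm j))
    (he.comp (fun j => (s.equivFin.symm j : ι))
      (Subtype.val_injective.comp s.equivFin.symm.injective))
  rw [s.equivFin.symm.sum_comp (fun x : s => ‖S (e x)‖ ^ 2)] at h1
  rwa [← Finset.sum_coe_sort s (fun x => ‖S (e x)‖ ^ 2)]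

/-- A finite orthonormal family almost realizing the Hilbert–Schmidt norm. -/
lemma HilbertSchmidtSqLE.exists_orthonormal {S : E →L[ℝ] F} {M : ℝ}
    (h : HilbertSchmidtSqLE S M) {ε : ℝ} (hε : 0 < ε) :
    ∃ (n : ℕ) (e : Fin n → E), Orthonormal ℝ e ∧
      ∀ x, (∀ i, inner ℝ (e i) x = 0) → ‖S x‖ ≤ ε * ‖x‖ := by
  let A : Set ℝ := {t | ∃ (n : ℕ) (e : Fin n → E), Orthonormal ℝ e ∧ t = ∑ i, ‖S (e i)‖ ^ 2}
  have hbdd : BddAbove A := ⟨M, by rintro _ ⟨n, e, he, rfl⟩; exact h n e he⟩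
  have hne : A.Nonempty := ⟨0, 0, fun i => i.elim0, by constructor <;> intro i <;> exact i.elim0,
    by simp⟩
  -- The family is within `ε²` of the supremum, so appending a further orthonormal vector adds at
  -- most `ε²`.
  obtain ⟨t, ⟨n, e, he, rfl⟩, ht⟩ := exists_lt_of_lt_csSup hne
    (show sSup A - ε ^ 2 < sSup A by have := pow_pos hε 2; linarith)
  refine ⟨n, e, he, fun x hx => ?_⟩
  rcases eq_or_ne x 0 with rfl | hx0
  · simp
  have hxn : 0 < ‖x‖ := norm_pos_iff.2 hx0
  have hy : ‖‖x‖⁻¹ • x‖ = 1 := by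
    rw [norm_smul, norm_inv, norm_norm, inv_mul_cancel₀ hxn.ne']
  have horth : Orthonormal ℝ (Fin.cons (‖x‖⁻¹ • x) e : Fin (n + 1) → E) := by
    rw [orthonormal_iff_ite] at he ⊢
    intro i j
    refine Fin.cases ?_ (fun i => ?_) i <;> refine Fin.cases ?_ (fun j => ?_) j
    · simp only [Fin.cons_zero, if_true]
      rw [real_inner_self_eq_norm_sq, hy, one_pow]
    · simp only [Fin.cons_zero, Fin.cons_succ]
      rw [real_inner_smul_left, real_inner_comm, hx, mul_zero, if_neg (Fin.succ_ne_zero j).symm]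
    · simp only [Fin.cons_zero, Fin.cons_succ]
      rw [real_inner_smul_right, hx, mul_zero, if_neg (Fin.succ_ne_zero i)]
    · simp only [Fin.cons_succ, Fin.succ_inj]
      exact he i j
  have hle := le_csSup hbdd ⟨n + 1, _, horth, rfl⟩
  rw [Fin.sum_univ_succ] at hle
  simp only [Fin.cons_zero, Fin.cons_succ] at hle
  have h2 : ‖S (‖x‖⁻¹ • x)‖ ^ 2 ≤ ε ^ 2 := by linarith
  have h3 := abs_le_of_sq_le_sq h2 hε.le
  rw [abs_norm] at h3
  rw [map_smul, norm_smul, norm_inv, norm_norm, inv_mul_le_iff₀ hxn] at h3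
  linarith [mul_comm ε ‖x‖]

/-- Hilbert–Schmidt operators are compact. -/
lemma HilbertSchmidtSqLE.isCompactOperator [CompleteSpace E] [CompleteSpace F]
    {S : E →L[ℝ] F} {M : ℝ}
    (h : HilbertSchmidtSqLE S M) : IsCompactOperator S := by
  -- `S` is a norm limit of the finite-rank operators `S ∘ P`, with `P` the projection onto the span
  -- of an almost maximizing family.
  have hmem : S ∈ closure {f : E →L[ℝ] F | IsCompactOperator f} := by
    rw [Metric.mem_closure_iff]
    intro ε hε
    obtain ⟨n, e, he, hS⟩ := h.exists_orthonormal (half_pos hε)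
    let V : Submodule ℝ E := Submodule.span ℝ (range e)
    have : FiniteDimensional ℝ V := FiniteDimensional.span_of_finite ℝ (finite_range e)
    refine ⟨(S ∘L V.subtypeL) ∘L V.orthogonalProjectionOnto, ?_, ?_⟩
    · exact (isCompactOperator_of_finiteDimensional (S ∘L V.subtypeL)).comp_clm _
    · rw [dist_eq_norm]
      refine lt_of_le_of_lt (ContinuousLinearMap.opNorm_le_bound _ (half_pos hε).le fun x => ?_)
        (half_lt_self hε)
      have h1 : (S - (S ∘L V.subtypeL) ∘L V.orthogonalProjectionOnto) x
          = S (x - V.starProjection x) := by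
        rw [map_sub]
        rfl
      rw [h1]
      have hperp : x - V.starProjection x ∈ Vᗮ := V.sub_starProjection_mem_orthogonal x
      refine (hS _ fun i => hperp _ (Submodule.subset_span ⟨i, rfl⟩)).trans ?_
      gcongr
      have h4 : x - V.starProjection x = Vᗮ.starProjection x := by
        rw [Submodule.starProjection_orthogonal_val]
      rw [h4]
      exact Submodule.norm_starProjection_apply_le _ x
  exact isClosed_setOfPred_isCompactOperator.closure_subset hmem

lemma HilbertSchmidtSqLE.isHilbertSchmidt {S : E →L[ℝ] F} {M : ℝ}
    (h : HilbertSchmidtSqLE S M) (R : F →L[ℝ] E) : IsHilbertSchmidt (R ∘L S) := by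
  intro s b
  refine Summable.of_nonneg_of_le (fun i => by positivity) (fun i => ?_)
    ((summable_of_sum_le (f := fun i => ‖S (b i)‖ ^ 2) (fun i => by positivity)
      (fun t => h.sum_le b.orthonormal t)).mul_left (‖R‖ ^ 2))
  rw [← mul_pow]
  gcongr
  exact R.le_opNorm _

/-- A family on which the form `‖S x‖² - ‖x‖²` is diagonal with positive entries has at most
`‖S‖²_HS` members. -/
lemma HilbertSchmidtSqLE.card_le {S : E →L[ℝ] F} {M : ℝ} (h : HilbertSchmidtSqLE S M)
    {ι : Type*} [Fintype ι] (x : ι → E) (d : ι → ℝ) (hd : ∀ i, 0 < d i)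
    (hdiag : ∀ i, inner ℝ (S (x i)) (S (x i)) = d i + inner ℝ (x i) (x i))
    (hoff : ∀ i j, i ≠ j → inner ℝ (S (x i)) (S (x j)) = inner ℝ (x i) (x j)) :
    (Fintype.card ι : ℝ) ≤ M := by
  classical
  -- The cross terms in `‖S x‖²` and `‖x‖²` agree, so their difference is `∑ cᵢ² dᵢ`. This yields
  -- both linear independence and `‖S x‖ ≥ ‖x‖` on the span.
  have hform : ∀ c : ι → ℝ, ‖S (∑ i, c i • x i)‖ ^ 2
      = ∑ i, c i ^ 2 * d i + ‖∑ i, c i • x i‖ ^ 2 := by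
    intro c
    have hij : ∀ i j, inner ℝ (S (x i)) (S (x j))
        = (if i = j then d i else 0) + inner ℝ (x i) (x j) := by
      intro i j
      split_ifs with hc
      · subst hc; exact hdiag i
      · rw [hoff i j hc, zero_add]
    rw [← real_inner_self_eq_norm_sq, ← real_inner_self_eq_norm_sq, map_sum]
    simp only [map_smul, sum_inner, inner_sum, real_inner_smul_left, real_inner_smul_right, hij,
      mul_add, Finset.sum_add_distrib]
    congr 1
    refine Finset.sum_congr rfl fun i _ => ?_
    simp only [mul_ite, mul_zero, Finset.sum_ite_eq', Finset.mem_univ, if_true]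
    ring
  have hli : LinearIndependent ℝ x := by
    rw [Fintype.linearIndependent_iff]
    intro c hc i
    have h1 := hform c
    rw [hc] at h1
    simp only [map_zero, norm_zero, ne_eq, OfNat.ofNat_ne_zero, not_false_eq_true, zero_pow,
      add_zero] at h1
    have h2 := (Finset.sum_eq_zero_iff_of_nonneg
      (fun j _ => mul_nonneg (sq_nonneg (c j)) (hd j).le)).1 h1.symm i (Finset.mem_univ i)
    simpa [(hd i).ne'] using h2
  let V : Submodule ℝ E := Submodule.span ℝ (range x)
  have : FiniteDimensional ℝ V := FiniteDimensional.span_of_finite ℝ (finite_range x)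
  have hdim : Module.finrank ℝ V = Fintype.card ι := finrank_span_eq_card hli
  let e := stdOrthonormalBasis ℝ V
  have he : Orthonormal ℝ (fun i => (e i : E)) := e.orthonormal.comp_linearIsometry V.subtypeₗᵢ
  have h1 := h _ _ he
  -- Each vector of an orthonormal basis of the span contributes at least `1` to the Hilbert–Schmidt
  -- sum.
  have h2 : ∀ i, 1 ≤ ‖S (e i : E)‖ ^ 2 := by
    intro i
    obtain ⟨c, hc⟩ := (Submodule.mem_span_range_iff_exists_fun ℝ).1 (e i).2
    have h3 := hform c
    rw [hc, he.1 i] at h3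
    have h4 : 0 ≤ ∑ i, c i ^ 2 * d i :=
      Finset.sum_nonneg fun j _ => mul_nonneg (sq_nonneg (c j)) (hd j).le
    linarith
  have h3 : (Fintype.card ι : ℝ) = ∑ _i : Fin (Module.finrank ℝ V), (1 : ℝ) := by
    simp [hdim]
  rw [h3]
  exact (Finset.sum_le_sum fun i _ => h2 i).trans h1

end HilbertSchmidt

/-! ### Weighted `L²` spaces and the functionals `h ↦ ∫₀^τ s h(s) ds` -/

/-- Lebesgue measure on the unit interval. -/
abbrev unitVol : Measure ℝ := volume.restrict (Ioo 0 1)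

/-- The measure `s / v(s) ds` on `[0,1]`. -/
def radialMeasure (v : ℝ → ℝ) : Measure ℝ :=
  (volume.restrict (Icc 0 1)).withDensity fun s => ENNReal.ofReal (s / v s)

/-- A measurable positive function on the open unit interval. -/
structure IsRadialWeight (v : ℝ → ℝ) : Prop where
  aemeasurable : AEMeasurable v unitVol
  pos : ∀ s ∈ Ioo (0 : ℝ) 1, 0 < v s

lemma radialMeasure_eq (v : ℝ → ℝ) :
    radialMeasure v = unitVol.withDensity fun s => ENNReal.ofReal (s / v s) := by
  rw [radialMeasure, ← Measure.restrict_congr_set Ioo_ae_eq_Icc]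

lemma ae_unitVol_mem : ∀ᵐ s ∂unitVol, s ∈ Ioo (0 : ℝ) 1 := ae_restrict_mem measurableSet_Ioo

namespace IsRadialWeight

variable {v : ℝ → ℝ}

lemma density_aemeasurable (hv : IsRadialWeight v) :
    AEMeasurable (fun s => ENNReal.ofReal (s / v s)) unitVol :=
  (aemeasurable_id.div hv.aemeasurable).ennreal_ofReal

/-- The density is positive inside the interval, so all radial weights have the same null sets.
Almost-everywhere statements thus pass between different values of `Ω`. -/
lemma ae_eq (hv : IsRadialWeight v) : ae (radialMeasure v) = ae unitVol := by
  rw [radialMeasure_eq]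
  refine le_antisymm (withDensity_absolutelyContinuous _ _).ae_le
    (withDensity_absolutelyContinuous' hv.density_aemeasurable ?_).ae_le
  filter_upwards [ae_unitVol_mem] with s hs
  exact (ENNReal.ofReal_pos.2 (div_pos hs.1 (hv.pos s hs))).ne'

lemma aestronglyMeasurable_iff (hv : IsRadialWeight v) {F : ℝ → ℝ} :
    AEStronglyMeasurable F (radialMeasure v) ↔ AEStronglyMeasurable F unitVol :=
  ⟨fun h => h.mono_ac (Measure.ae_le_iff_absolutelyContinuous.1 hv.ae_eq.ge),
    fun h => h.mono_ac (Measure.ae_le_iff_absolutelyContinuous.1 hv.ae_eq.le)⟩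

lemma integrable_iff (hv : IsRadialWeight v) {F : ℝ → ℝ} :
    Integrable F (radialMeasure v) ↔ Integrable (fun s => s / v s * F s) unitVol := by
  rw [radialMeasure_eq, integrable_withDensity_iff_integrable_smul₀' hv.density_aemeasurable
    (ae_of_all _ fun s => ENNReal.ofReal_lt_top)]
  refine integrable_congr ?_
  filter_upwards [ae_unitVol_mem] with s hs
  rw [ENNReal.toReal_ofReal (div_pos hs.1 (hv.pos s hs)).le, smul_eq_mul]

lemma integral_eq (hv : IsRadialWeight v) (F : ℝ → ℝ) :
    ∫ s, F s ∂radialMeasure v = ∫ s, s / v s * F s ∂unitVol := by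
  rw [radialMeasure_eq, integral_withDensity_eq_integral_toReal_smul₀ hv.density_aemeasurable
    (ae_of_all _ fun s => ENNReal.ofReal_lt_top)]
  refine integral_congr_ae ?_
  filter_upwards [ae_unitVol_mem] with s hs
  rw [ENNReal.toReal_ofReal (div_pos hs.1 (hv.pos s hs)).le, smul_eq_mul]

lemma inner_toLp (hv : IsRadialWeight v) {F H : ℝ → ℝ} (hF : MemLp F 2 (radialMeasure v))
    (hH : MemLp H 2 (radialMeasure v)) :
    inner ℝ (hF.toLp F) (hH.toLp H) = ∫ s, s / v s * (F s * H s) ∂unitVol := by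
  rw [L2.inner_def, ← hv.integral_eq]
  refine integral_congr_ae ?_
  filter_upwards [hF.coeFn_toLp, hH.coeFn_toLp] with s h1 h2
  rw [h1, h2, real_inner_eq_re_inner]
  simp [mul_comm]

/-- Truncations of the weight represent the functionals `h ↦ ∫₀^τ s h(s) ds`. -/
lemma memLp_indicator (hv : IsRadialWeight v) {τ : ℝ}
    (hint : IntegrableOn (fun s => s * v s) (Ioo 0 τ)) :
    MemLp ((Ioo 0 τ).indicator v) 2 (radialMeasure v) := by
  rw [memLp_two_iff_integrable_sq, hv.integrable_iff]
  · have h1 : Integrable ((Ioo 0 τ).indicator fun s => s * v s) unitVol :=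
      ((integrable_indicator_iff measurableSet_Ioo).2 hint).mono_measure Measure.restrict_le_self
    refine h1.congr ?_
    filter_upwards [ae_unitVol_mem] with s hs
    by_cases h : s ∈ Ioo 0 τ
    · simp only [indicator_of_mem h]
      have := (hv.pos s hs).ne'
      field_simp
    · simp [indicator_of_notMem h]
  · rw [hv.aestronglyMeasurable_iff]
    exact hv.aemeasurable.aestronglyMeasurable.indicator measurableSet_Ioo

lemma indicator_mul_ae (hv : IsRadialWeight v) (τ : ℝ) (h : ℝ → ℝ) :
    (fun s => s / v s * ((Ioo 0 τ).indicator v s * h s))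
      =ᵐ[unitVol] (Ioo 0 τ).indicator fun s => s * h s := by
  filter_upwards [ae_unitVol_mem] with s hs
  by_cases hm : s ∈ Ioo 0 τ
  · simp only [indicator_of_mem hm]
    have := (hv.pos s hs).ne'
    field_simp
  · simp [indicator_of_notMem hm]

lemma integral_indicator_unitVol {τ : ℝ} (hτ : τ ≤ 1) (G : ℝ → ℝ) :
    ∫ s, (Ioo 0 τ).indicator G s ∂unitVol = ∫ s in Ioo 0 τ, G s := by
  rw [integral_indicator measurableSet_Ioo, Measure.restrict_restrict measurableSet_Ioo,
    inter_eq_left.2 (Ioo_subset_Ioo_right hτ)]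

lemma integrableOn_mul (hv : IsRadialWeight v) {τ : ℝ} (hτ : τ ≤ 1)
    (hint : IntegrableOn (fun s => s * v s) (Ioo 0 τ)) {h : ℝ → ℝ}
    (hh : MemLp h 2 (radialMeasure v)) :
    IntegrableOn (fun s => s * h s) (Ioo 0 τ) := by
  have h1 := (hv.memLp_indicator hint).integrable_mul hh
  rw [hv.integrable_iff] at h1
  have h2 := h1.congr (hv.indicator_mul_ae τ h)
  rwa [integrable_indicator_iff measurableSet_Ioo, IntegrableOn,
    Measure.restrict_restrict measurableSet_Ioo, inter_eq_left.2 (Ioo_subset_Ioo_right hτ)] at h2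

lemma inner_indicator (hv : IsRadialWeight v) {τ : ℝ} (hτ : τ ≤ 1)
    (hint : IntegrableOn (fun s => s * v s) (Ioo 0 τ)) {h : ℝ → ℝ}
    (hh : MemLp h 2 (radialMeasure v)) :
    inner ℝ ((hv.memLp_indicator hint).toLp _) (hh.toLp h) = ∫ s in Ioo 0 τ, s * h s := by
  rw [hv.inner_toLp, integral_congr_ae (hv.indicator_mul_ae τ h), integral_indicator_unitVol hτ]

lemma norm_sq_indicator (hv : IsRadialWeight v) {τ : ℝ} (hτ : τ ≤ 1)
    (hint : IntegrableOn (fun s => s * v s) (Ioo 0 τ)) :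
    ‖(hv.memLp_indicator hint).toLp _‖ ^ 2 = ∫ s in Ioo 0 τ, s * v s := by
  rw [← real_inner_self_eq_norm_sq, hv.inner_indicator hτ hint]
  refine setIntegral_congr_fun measurableSet_Ioo fun s hs => ?_
  simp only [indicator_of_mem hs]

/-- Bessel's inequality for the functionals `h ↦ ∫₀^τ s h(s) ds`. -/
lemma sum_sq_le (hv : IsRadialWeight v) {τ : ℝ} (hτ : τ ≤ 1)
    (hint : IntegrableOn (fun s => s * v s) (Ioo 0 τ)) {n : ℕ}
    {e : Fin n → Lp ℝ 2 (radialMeasure v)} (he : Orthonormal ℝ e) :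
    ∑ i, (∫ s in Ioo 0 τ, s * e i s) ^ 2 ≤ ∫ s in Ioo 0 τ, s * v s := by
  rw [← hv.norm_sq_indicator hτ hint]
  refine le_trans (le_of_eq ?_)
    (he.sum_inner_products_le (s := Finset.univ) ((hv.memLp_indicator hint).toLp _))
  refine Finset.sum_congr rfl fun i _ => ?_
  rw [← hv.inner_indicator hτ hint (Lp.memLp (e i)), Lp.toLp_coeFn, real_inner_comm,
    Real.norm_eq_abs, sq_abs]

/-- The Cauchy–Schwarz inequality for the functionals `h ↦ ∫₀^τ s h(s) ds`. -/
lemma sq_le (hv : IsRadialWeight v) {τ : ℝ} (hτ : τ ≤ 1)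
    (hint : IntegrableOn (fun s => s * v s) (Ioo 0 τ)) (h : Lp ℝ 2 (radialMeasure v)) :
    (∫ s in Ioo 0 τ, s * h s) ^ 2 ≤ (∫ s in Ioo 0 τ, s * v s) * ‖h‖ ^ 2 := by
  rw [← hv.norm_sq_indicator hτ hint, ← hv.inner_indicator hτ hint (Lp.memLp h), Lp.toLp_coeFn,
    ← mul_pow, ← sq_abs]
  gcongr
  exact abs_real_inner_le_norm _ _

end IsRadialWeight

/-! ### The square root of the potential for weights with a simple pole -/

/-- A radial weight with at most a simple pole at `1`. -/
structure IsSubcriticalWeight (v : ℝ → ℝ) (C : ℝ) : Prop extends IsRadialWeight v where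
  le_div : ∀ s ∈ Ioo (0 : ℝ) 1, v s ≤ C / (1 - s)

/-- `τ ↦ τ^{-1/2} ∫₀^τ s h(s) ds`. -/
def radialHalf (h : ℝ → ℝ) (τ : ℝ) : ℝ := (√τ)⁻¹ * ∫ s in Ioo 0 τ, s * h s

lemma radialHalf_congr {h k : ℝ → ℝ} (hhk : h =ᵐ[unitVol] k) {τ : ℝ} (hτ : τ ≤ 1) :
    radialHalf h τ = radialHalf k τ := by
  unfold radialHalf
  congr 1
  refine integral_congr_ae ?_
  have h1 : h =ᵐ[volume.restrict (Ioo 0 τ)] k :=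
    ae_restrict_of_ae_restrict_of_subset (Ioo_subset_Ioo_right hτ) hhk
  filter_upwards [h1] with s hs
  rw [hs]

/-- A simple pole integrates to a logarithm, whose integrability makes the Hilbert–Schmidt bound
finite. -/
lemma integrable_neg_log_one_sub : Integrable (fun τ : ℝ => -Real.log (1 - τ)) unitVol := by
  have h1 : IntervalIntegrable Real.log volume 0 1 := intervalIntegral.intervalIntegrable_log'
  have h2 := (h1.comp_sub_left 1).symm.neg
  simp only [sub_self, sub_zero] at h2
  exact ((intervalIntegrable_iff_integrableOn_Ioo_of_le zero_le_one).1 h2)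

namespace IsSubcriticalWeight

variable {v : ℝ → ℝ} {C : ℝ}

lemma integrableOn_inv_one_sub {τ : ℝ} (h1 : τ < 1) :
    IntegrableOn (fun s : ℝ => (1 - s)⁻¹) (Ioo 0 τ) := by
  refine (ContinuousOn.integrableOn_Icc (a := 0) (b := τ) ?_).mono_set Ioo_subset_Icc_self
  refine ContinuousOn.inv₀ (by fun_prop) fun s hs => ?_
  have := hs.2
  linarith

lemma integral_inv_one_sub {τ : ℝ} (h0 : 0 < τ) (h1 : τ < 1) :
    ∫ s in Ioo 0 τ, (1 - s)⁻¹ = -Real.log (1 - τ) := by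
  rw [← integral_Ioc_eq_integral_Ioo, ← intervalIntegral.integral_of_le h0.le,
    intervalIntegral.integral_comp_sub_left (fun x : ℝ => x⁻¹) 1, sub_zero,
    integral_inv_of_pos (by linarith) one_pos, one_div, Real.log_inv]

lemma integrableOn_mul_weight (hv : IsSubcriticalWeight v C) {τ : ℝ} (h1 : τ < 1) :
    IntegrableOn (fun s => s * v s) (Ioo 0 τ) := by
  refine ((integrableOn_inv_one_sub h1).const_mul C).mono' ?_ ?_
  · have h2 : AEMeasurable v (volume.restrict (Ioo 0 τ)) :=
      hv.aemeasurable.mono_measure (Measure.restrict_mono (Ioo_subset_Ioo_right h1.le) le_rfl)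
    exact (aemeasurable_id.mul h2).aestronglyMeasurable
  · refine (ae_restrict_iff' measurableSet_Ioo).2 (ae_of_all _ fun s hs => ?_)
    have hs' : s ∈ Ioo (0 : ℝ) 1 := ⟨hs.1, hs.2.trans h1⟩
    have h2 := hv.le_div s hs'
    have h3 := hv.pos s hs'
    rw [div_eq_mul_inv] at h2
    rw [Real.norm_of_nonneg (mul_pos hs.1 h3).le]
    nlinarith [hs'.2]

/-- Using `s ≤ τ` rather than `s ≤ 1` keeps a factor `τ`, which cancels the `τ⁻¹` in `radialHalf h τ
^ 2`. -/
lemma integral_mul_weight_le (hv : IsSubcriticalWeight v C) {τ : ℝ} (h0 : 0 < τ) (h1 : τ < 1) :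
    ∫ s in Ioo 0 τ, s * v s ≤ τ * (C * -Real.log (1 - τ)) := by
  rw [← integral_inv_one_sub h0 h1, ← integral_const_mul, ← integral_const_mul]
  refine setIntegral_mono_on (hv.integrableOn_mul_weight h1)
    (((integrableOn_inv_one_sub h1).const_mul C).const_mul τ) measurableSet_Ioo fun s hs => ?_
  have hs' : s ∈ Ioo (0 : ℝ) 1 := ⟨hs.1, hs.2.trans h1⟩
  have h2 := hv.le_div s hs'
  rw [div_eq_mul_inv] at h2
  exact mul_le_mul hs.2.le h2 (hv.pos s hs').le h0.le

lemma sq_radialHalf_eq (h : ℝ → ℝ) {τ : ℝ} (h0 : 0 < τ) :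
    radialHalf h τ ^ 2 = τ⁻¹ * (∫ s in Ioo 0 τ, s * h s) ^ 2 := by
  rw [radialHalf, mul_pow, inv_pow, Real.sq_sqrt h0.le]

lemma sq_radialHalf_le (hv : IsSubcriticalWeight v C) (h : Lp ℝ 2 (radialMeasure v)) {τ : ℝ}
    (hτ : τ ∈ Ioo (0 : ℝ) 1) :
    radialHalf h τ ^ 2 ≤ C * -Real.log (1 - τ) * ‖h‖ ^ 2 := by
  rw [sq_radialHalf_eq _ hτ.1, inv_mul_le_iff₀ hτ.1, ← mul_assoc]
  refine (hv.sq_le hτ.2.le (hv.integrableOn_mul_weight hτ.2) h).trans ?_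
  gcongr
  exact hv.integral_mul_weight_le hτ.1 hτ.2

lemma sum_sq_radialHalf_le (hv : IsSubcriticalWeight v C) {n : ℕ}
    {e : Fin n → Lp ℝ 2 (radialMeasure v)} (he : Orthonormal ℝ e) {τ : ℝ}
    (hτ : τ ∈ Ioo (0 : ℝ) 1) :
    ∑ i, radialHalf (e i) τ ^ 2 ≤ C * -Real.log (1 - τ) := by
  simp only [sq_radialHalf_eq _ hτ.1]
  rw [← Finset.mul_sum, inv_mul_le_iff₀ hτ.1]
  exact (hv.sum_sq_le hτ.2.le (hv.integrableOn_mul_weight hτ.2) he).trans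
    (hv.integral_mul_weight_le hτ.1 hτ.2)

lemma measurable_radialHalf {h : ℝ → ℝ} (hh : StronglyMeasurable h) :
    StronglyMeasurable (radialHalf h) := by
  have h1 : StronglyMeasurable fun τ : ℝ => ∫ s, (Ioo 0 τ).indicator (fun s => s * h s) s := by
    refine StronglyMeasurable.integral_prod_right (f := fun τ s : ℝ =>
      (Ioo 0 τ).indicator (fun s => s * h s) s) ?_
    have h2 : StronglyMeasurable fun p : ℝ × ℝ => p.2 * h p.2 :=
      measurable_snd.stronglyMeasurable.mul (hh.comp_measurable measurable_snd)
    have h3 : MeasurableSet {p : ℝ × ℝ | 0 < p.2 ∧ p.2 < p.1} :=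
      (measurableSet_lt measurable_const measurable_snd).inter
        (measurableSet_lt measurable_snd measurable_fst)
    exact h2.indicator h3
  simp only [integral_indicator measurableSet_Ioo] at h1
  exact (Real.continuous_sqrt.measurable.inv.stronglyMeasurable).mul h1

lemma memLp_radialHalf (hv : IsSubcriticalWeight v C) (h : Lp ℝ 2 (radialMeasure v)) :
    MemLp (radialHalf h) 2 unitVol := by
  have hm := (measurable_radialHalf (Lp.stronglyMeasurable h)).aestronglyMeasurable (μ := unitVol)
  rw [memLp_two_iff_integrable_sq hm]
  refine ((integrable_neg_log_one_sub.const_mul C).mul_const (‖h‖ ^ 2)).mono' (hm.pow 2) ?_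
  filter_upwards [ae_unitVol_mem] with τ hτ
  rw [Real.norm_of_nonneg (sq_nonneg _)]
  exact hv.sq_radialHalf_le h hτ

lemma norm_sq_toLp_unitVol {F : ℝ → ℝ} (hF : MemLp F 2 unitVol) :
    ‖hF.toLp F‖ ^ 2 = ∫ τ, F τ ^ 2 ∂unitVol := by
  rw [← real_inner_self_eq_norm_sq, L2.inner_def]
  refine integral_congr_ae ?_
  filter_upwards [hF.coeFn_toLp] with s h1
  rw [h1, real_inner_self_eq_norm_sq, Real.norm_eq_abs, sq_abs]

lemma norm_toLp_radialHalf_le (hv : IsSubcriticalWeight v C) (h : Lp ℝ 2 (radialMeasure v)) :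
    ‖(hv.memLp_radialHalf h).toLp _‖ ≤ √(∫ τ, C * -Real.log (1 - τ) ∂unitVol) * ‖h‖ := by
  rw [← Real.sqrt_sq (norm_nonneg h), ← Real.sqrt_mul']
  · refine Real.le_sqrt_of_sq_le ?_
    rw [norm_sq_toLp_unitVol, ← integral_mul_const]
    refine integral_mono_ae (hv.memLp_radialHalf h).integrable_sq
      ((integrable_neg_log_one_sub.const_mul C).mul_const (‖h‖ ^ 2)) ?_
    filter_upwards [ae_unitVol_mem] with τ hτ
    exact hv.sq_radialHalf_le h hτ
  · positivity

/-- The pole may destroy integrability up to `1`, so linearity of `radialHalf` is only claimed for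
`τ < 1`; this suffices almost everywhere. -/
lemma integrableOn_mul_of_lt (hv : IsSubcriticalWeight v C) {τ : ℝ} (hτ : τ < 1)
    (h : Lp ℝ 2 (radialMeasure v)) : IntegrableOn (fun s => s * h s) (Ioo 0 τ) :=
  hv.integrableOn_mul hτ.le (hv.integrableOn_mul_weight hτ) (Lp.memLp h)

lemma radialHalf_add (hv : IsSubcriticalWeight v C) (h k : Lp ℝ 2 (radialMeasure v)) {τ : ℝ}
    (hτ : τ < 1) : radialHalf (h + k : Lp ℝ 2 (radialMeasure v)) τ
      = radialHalf h τ + radialHalf k τ := by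
  have h1 : (h + k : Lp ℝ 2 (radialMeasure v)) =ᵐ[unitVol] fun s => h s + k s := by
    have := Lp.coeFn_add h k
    rwa [Filter.EventuallyEq, hv.ae_eq] at this
  rw [radialHalf_congr h1 hτ.le, radialHalf, radialHalf, radialHalf, ← mul_add,
    ← integral_add (hv.integrableOn_mul_of_lt hτ h) (hv.integrableOn_mul_of_lt hτ k)]
  simp only [mul_add]

lemma radialHalf_smul (hv : IsSubcriticalWeight v C) (c : ℝ) (h : Lp ℝ 2 (radialMeasure v))
    {τ : ℝ} (hτ : τ < 1) : radialHalf (c • h : Lp ℝ 2 (radialMeasure v)) τ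
      = c * radialHalf h τ := by
  have h1 : (c • h : Lp ℝ 2 (radialMeasure v)) =ᵐ[unitVol] fun s => c * h s := by
    have := Lp.coeFn_smul c h
    rwa [Filter.EventuallyEq, hv.ae_eq] at this
  have h2 : ∫ s in Ioo 0 τ, s * (c * h s) = c * ∫ s in Ioo 0 τ, s * h s := by
    rw [← integral_const_mul]
    simp only [mul_left_comm c]
  rw [radialHalf_congr h1 hτ.le, radialHalf, radialHalf, h2, mul_left_comm]

/-- The operator `h ↦ τ^{-1/2} ∫₀^τ s h(s) ds`, a square root of the radial potential. -/
def halfOp (hv : IsSubcriticalWeight v C) : Lp ℝ 2 (radialMeasure v) →L[ℝ] Lp ℝ 2 unitVol :=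
  LinearMap.mkContinuous
    { toFun := fun h => (hv.memLp_radialHalf h).toLp _
      map_add' := fun h k => by
        rw [← MemLp.toLp_add]
        refine MemLp.toLp_congr _ _ ?_
        filter_upwards [ae_unitVol_mem] with τ hτ
        exact hv.radialHalf_add h k hτ.2
      map_smul' := fun c h => by
        rw [RingHom.id_apply, ← MemLp.toLp_const_smul]
        refine MemLp.toLp_congr _ _ ?_
        filter_upwards [ae_unitVol_mem] with τ hτ
        exact hv.radialHalf_smul c h hτ.2 }
    (√(∫ τ, C * -Real.log (1 - τ) ∂unitVol)) hv.norm_toLp_radialHalf_le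

lemma halfOp_apply (hv : IsSubcriticalWeight v C) (h : Lp ℝ 2 (radialMeasure v)) :
    hv.halfOp h = (hv.memLp_radialHalf h).toLp _ := rfl

/-- Bessel's inequality holds pointwise in `τ`, with a bound independent of the family; integrate
it. -/
lemma hilbertSchmidtSqLE_halfOp (hv : IsSubcriticalWeight v C) :
    HilbertSchmidtSqLE hv.halfOp (∫ τ, C * -Real.log (1 - τ) ∂unitVol) := by
  intro n e he
  simp only [halfOp_apply, norm_sq_toLp_unitVol]
  rw [← integral_finsetSum _ fun i _ => (hv.memLp_radialHalf (e i)).integrable_sq]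
  refine integral_mono_ae (integrable_finsetSum _ fun i _ =>
    (hv.memLp_radialHalf (e i)).integrable_sq) (integrable_neg_log_one_sub.const_mul C) ?_
  filter_upwards [ae_unitVol_mem] with τ hτ
  exact hv.sum_sq_radialHalf_le he hτ

lemma inner_halfOp (hv : IsSubcriticalWeight v C) (h k : Lp ℝ 2 (radialMeasure v)) :
    inner ℝ (hv.halfOp h) (hv.halfOp k)
      = ∫ τ, radialHalf h τ * radialHalf k τ ∂unitVol := by
  rw [halfOp_apply, halfOp_apply, L2.inner_def]
  refine integral_congr_ae ?_
  filter_upwards [(hv.memLp_radialHalf h).coeFn_toLp, (hv.memLp_radialHalf k).coeFn_toLp]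
    with s h1 h2
  rw [h1, h2]
  simp [mul_comm]

end IsSubcriticalWeight

/-! ### Bounded weights and the potential operator -/

/-- A radial weight bounded by `C`. -/
structure IsBoundedWeight (v : ℝ → ℝ) (C : ℝ) : Prop extends IsRadialWeight v where
  le_const : ∀ s ∈ Ioo (0 : ℝ) 1, v s ≤ C

lemma intervalIntegral_eq_Ioo {τ : ℝ} (hτ : 0 ≤ τ) (G : ℝ → ℝ) :
    ∫ s in (0 : ℝ)..τ, G s = ∫ s in Ioo 0 τ, G s := by
  rw [intervalIntegral.integral_of_le hτ, integral_Ioc_eq_integral_Ioo]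

lemma radialAverage_eq {τ : ℝ} (hτ : 0 ≤ τ) (h : ℝ → ℝ) :
    radialAverage h τ = τ⁻¹ * ∫ s in Ioo 0 τ, s * h s := by
  rw [radialAverage, intervalIntegral_eq_Ioo hτ, one_div]

lemma radialAverage_eq_radialHalf {τ : ℝ} (hτ : 0 ≤ τ) (h : ℝ → ℝ) :
    radialAverage h τ = (√τ)⁻¹ * radialHalf h τ := by
  rw [radialAverage_eq hτ, radialHalf, ← mul_assoc, ← mul_inv, Real.mul_self_sqrt hτ]

lemma radialHalf_mul_radialHalf {τ : ℝ} (hτ : 0 ≤ τ) (h k : ℝ → ℝ) :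
    radialHalf h τ * radialHalf k τ = radialAverage h τ * ∫ s in Ioo 0 τ, s * k s := by
  rw [radialAverage_eq_radialHalf hτ, radialHalf, radialHalf]
  ring

lemma radialPotential_eq {r : ℝ} (hr : r ≤ 1) (h : ℝ → ℝ) :
    radialPotential h r = ∫ τ in Ioo r 1, radialAverage h τ := by
  rw [radialPotential, intervalIntegral.integral_of_le hr, integral_Ioc_eq_integral_Ioo]

/-- Fubini's theorem over the triangle `{s < τ}`. -/
lemma integral_triangle_swap {F G : ℝ → ℝ} (hF : Integrable F unitVol)
    (hG : Integrable G unitVol) :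
    ∫ s, G s * (∫ τ in Ioo s 1, F τ) ∂unitVol
      = ∫ τ, F τ * (∫ s in Ioo 0 τ, G s) ∂unitVol := by
  have hprod : Integrable (Function.uncurry fun s τ : ℝ => if s < τ then G s * F τ else 0)
      (unitVol.prod unitVol) := by
    have h3 : MeasurableSet {p : ℝ × ℝ | p.1 < p.2} :=
      measurableSet_lt measurable_fst measurable_snd
    refine ((hG.mul_prod hF).indicator h3).congr (ae_of_all _ fun p => ?_)
    simp only [indicator, mem_ofPred_eq, Function.uncurry]
  have h1 := integral_integral_swap hprod
  calc ∫ s, G s * (∫ τ in Ioo s 1, F τ) ∂unitVol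
      = ∫ s, ∫ τ, (if s < τ then G s * F τ else 0) ∂unitVol ∂unitVol := by
        refine integral_congr_ae ?_
        filter_upwards [ae_unitVol_mem] with s hs
        rw [← integral_const_mul, ← integral_indicator measurableSet_Ioo,
          ← integral_indicator measurableSet_Ioo]
        refine integral_congr_ae (ae_of_all _ fun τ => ?_)
        by_cases h : s < τ
        · by_cases h' : τ < 1
          · simp [indicator, h, h', hs.1.trans h]
          · simp [indicator, h']
        · simp [indicator, h]
    _ = ∫ τ, ∫ s, (if s < τ then G s * F τ else 0) ∂unitVol ∂unitVol := h1
    _ = ∫ τ, F τ * (∫ s in Ioo 0 τ, G s) ∂unitVol := by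
        refine integral_congr_ae ?_
        filter_upwards [ae_unitVol_mem] with τ hτ
        rw [← integral_const_mul, ← integral_indicator measurableSet_Ioo,
          ← integral_indicator measurableSet_Ioo]
        refine integral_congr_ae (ae_of_all _ fun s => ?_)
        by_cases h : s < τ
        · by_cases h' : 0 < s
          · simp [indicator, h, h', h.trans hτ.2, mul_comm]
          · simp [indicator, h']
        · simp [indicator, h]

namespace IsBoundedWeight

variable {v : ℝ → ℝ} {C : ℝ}

lemma const_pos (hv : IsBoundedWeight v C) : 0 < C := by
  have h1 : (1 / 2 : ℝ) ∈ Ioo (0 : ℝ) 1 := by constructor <;> norm_num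
  exact (hv.pos _ h1).trans_le (hv.le_const _ h1)

lemma isSubcriticalWeight (hv : IsBoundedWeight v C) : IsSubcriticalWeight v C where
  toIsRadialWeight := hv.toIsRadialWeight
  le_div s hs := (hv.le_const s hs).trans <| by
    rw [le_div_iff₀ (by linarith [hs.2])]
    nlinarith [hs.1, hv.const_pos]

lemma integrableOn_mul_weight (hv : IsBoundedWeight v C) {τ : ℝ} (h1 : τ ≤ 1) :
    IntegrableOn (fun s => s * v s) (Ioo 0 τ) := by
  refine (integrable_const (μ := volume.restrict (Ioo 0 τ)) C).mono' ?_ ?_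
  · have h2 : AEMeasurable v (volume.restrict (Ioo 0 τ)) :=
      hv.aemeasurable.mono_measure (Measure.restrict_mono (Ioo_subset_Ioo_right h1) le_rfl)
    exact (aemeasurable_id.mul h2).aestronglyMeasurable
  · refine (ae_restrict_iff' measurableSet_Ioo).2 (ae_of_all _ fun s hs => ?_)
    have hs' : s ∈ Ioo (0 : ℝ) 1 := ⟨hs.1, hs.2.trans_le h1⟩
    have h2 := hv.le_const s hs'
    have h3 := hv.pos s hs'
    rw [Real.norm_of_nonneg (mul_pos hs.1 h3).le]
    nlinarith [hs'.2]

lemma integral_mul_weight_le (hv : IsBoundedWeight v C) {τ : ℝ} (h0 : 0 ≤ τ) (h1 : τ ≤ 1) :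
    ∫ s in Ioo 0 τ, s * v s ≤ C * τ ^ 2 := by
  have h2 : ∫ s in Ioo 0 τ, τ * C = C * τ ^ 2 := by
    rw [setIntegral_const, measureReal_def, Real.volume_Ioo, sub_zero, ENNReal.toReal_ofReal h0,
      smul_eq_mul]
    ring
  rw [← h2]
  refine setIntegral_mono_on (hv.integrableOn_mul_weight h1)
    (integrable_const _) measurableSet_Ioo fun s hs => ?_
  have hs' : s ∈ Ioo (0 : ℝ) 1 := ⟨hs.1, hs.2.trans_le h1⟩
  exact mul_le_mul hs.2.le (hv.le_const s hs') (hv.pos s hs').le h0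

lemma integrable_mul (hv : IsBoundedWeight v C) (h : Lp ℝ 2 (radialMeasure v)) :
    Integrable (fun s => s * h s) unitVol :=
  hv.integrableOn_mul le_rfl (hv.integrableOn_mul_weight le_rfl) (Lp.memLp h)

lemma intervalIntegrable_mul (hv : IsBoundedWeight v C) (h : Lp ℝ 2 (radialMeasure v)) :
    IntervalIntegrable (fun s => s * h s) volume 0 1 :=
  (intervalIntegrable_iff_integrableOn_Ioo_of_le zero_le_one).2 (hv.integrable_mul h)

/-- By Cauchy–Schwarz the inner integral is `O(τ)`, because `∫₀^τ s v ≤ C τ²`; this absorbs the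
singular factor `1/τ`. -/
lemma abs_radialAverage_le (hv : IsBoundedWeight v C) (h : Lp ℝ 2 (radialMeasure v)) {τ : ℝ}
    (hτ : τ ∈ Ioo (0 : ℝ) 1) : |radialAverage h τ| ≤ √C * ‖h‖ := by
  rw [radialAverage_eq hτ.1.le, abs_mul, abs_inv, abs_of_pos hτ.1, inv_mul_le_iff₀ hτ.1]
  refine abs_le_of_sq_le_sq ?_ (mul_nonneg hτ.1.le (by positivity))
  refine (hv.sq_le hτ.2.le (hv.integrableOn_mul_weight hτ.2.le) h).trans ?_
  rw [mul_pow, mul_pow, Real.sq_sqrt hv.const_pos.le, ← mul_assoc, mul_comm (τ ^ 2)]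
  gcongr
  exact hv.integral_mul_weight_le hτ.1.le hτ.2.le

lemma integrable_radialAverage (hv : IsBoundedWeight v C) (h : Lp ℝ 2 (radialMeasure v)) :
    Integrable (radialAverage h) unitVol := by
  refine (integrable_const (√C * ‖h‖)).mono' ?_ ?_
  · have h1 : StronglyMeasurable fun τ => (√τ)⁻¹ * radialHalf h τ :=
      (Real.continuous_sqrt.measurable.inv.stronglyMeasurable).mul
        (IsSubcriticalWeight.measurable_radialHalf (Lp.stronglyMeasurable h))
    refine h1.aestronglyMeasurable.congr ?_
    filter_upwards [ae_unitVol_mem] with τ hτ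
    exact (radialAverage_eq_radialHalf hτ.1.le h).symm
  · filter_upwards [ae_unitVol_mem] with τ hτ
    exact hv.abs_radialAverage_le h hτ

lemma intervalIntegrable_radialAverage (hv : IsBoundedWeight v C)
    (h : Lp ℝ 2 (radialMeasure v)) : IntervalIntegrable (radialAverage h) volume 0 1 :=
  (intervalIntegrable_iff_integrableOn_Ioo_of_le zero_le_one).2 (hv.integrable_radialAverage h)

lemma continuousOn_radialPotential (hv : IsBoundedWeight v C) (h : Lp ℝ 2 (radialMeasure v)) :
    ContinuousOn (radialPotential h) (Icc 0 1) := by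
  have h1 := intervalIntegral.continuousOn_primitive_interval'
    (hv.intervalIntegrable_radialAverage h) (right_mem_uIcc (a := (0 : ℝ)) (b := 1))
  rw [uIcc_of_le zero_le_one] at h1
  refine h1.neg.congr fun r _ => ?_
  exact intervalIntegral.integral_symm _ _

lemma aestronglyMeasurable_radialPotential (hv : IsBoundedWeight v C)
    (h : Lp ℝ 2 (radialMeasure v)) : AEStronglyMeasurable (radialPotential h) unitVol :=
  ((hv.continuousOn_radialPotential h).mono Ioo_subset_Icc_self).aestronglyMeasurable
    measurableSet_Ioo

lemma exists_abs_radialPotential_le (hv : IsBoundedWeight v C) (h : Lp ℝ 2 (radialMeasure v)) :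
    ∃ B, ∀ r ∈ Icc (0 : ℝ) 1, |radialPotential h r| ≤ B :=
  isCompact_Icc.exists_bound_of_continuousOn (hv.continuousOn_radialPotential h)

/-- The radial potential is the square of `radialHalf`, in the sense of quadratic forms. -/
lemma integral_mul_radialPotential (hv : IsBoundedWeight v C) (h : Lp ℝ 2 (radialMeasure v))
    {k : ℝ → ℝ} (hk : Integrable (fun s => s * k s) unitVol) :
    ∫ s, s * k s * radialPotential h s ∂unitVol
      = ∫ τ, radialHalf h τ * radialHalf k τ ∂unitVol := by
  have h1 := integral_triangle_swap (hv.integrable_radialAverage h) hk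
  rw [integral_congr_ae (g := fun s => s * k s * ∫ τ in Ioo s 1, radialAverage h τ) ?_, h1]
  · refine integral_congr_ae ?_
    filter_upwards [ae_unitVol_mem] with τ hτ
    exact (radialHalf_mul_radialHalf hτ.1.le h k).symm
  · filter_upwards [ae_unitVol_mem] with s hs
    rw [radialPotential_eq hs.2.le]

lemma memLp_mul_radialPotential (hv : IsBoundedWeight v C) (h : Lp ℝ 2 (radialMeasure v)) :
    MemLp (fun r => v r * radialPotential h r) 2 (radialMeasure v) := by
  have hm : AEStronglyMeasurable (fun r => v r * radialPotential h r) unitVol :=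
    hv.aemeasurable.aestronglyMeasurable.mul (hv.aestronglyMeasurable_radialPotential h)
  rw [memLp_two_iff_integrable_sq (hv.aestronglyMeasurable_iff.2 hm), hv.integrable_iff]
  obtain ⟨B, hB⟩ := hv.exists_abs_radialPotential_le h
  refine (integrable_const (C * B ^ 2)).mono' ?_ ?_
  · exact ((aemeasurable_id.div hv.aemeasurable).aestronglyMeasurable).mul (hm.pow 2)
  · filter_upwards [ae_unitVol_mem] with s hs
    have h1 := hv.pos s hs
    have h2 : s / v s * (v s * radialPotential h s) ^ 2
        = s * v s * |radialPotential h s| ^ 2 := by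
      rw [sq_abs]; field_simp
    rw [h2, Real.norm_of_nonneg (mul_nonneg (mul_pos hs.1 h1).le (sq_nonneg _))]
    have h3 := hB s ⟨hs.1.le, hs.2.le⟩
    have h4 : s * v s ≤ C := by nlinarith [hv.le_const s hs, hs.2]
    have := hv.const_pos.le
    gcongr

/-- The operator `h ↦ v K h`, where `K` is the radial potential. -/
def potentialOp (hv : IsBoundedWeight v C) :
    Lp ℝ 2 (radialMeasure v) →L[ℝ] Lp ℝ 2 (radialMeasure v) :=
  ContinuousLinearMap.adjoint hv.isSubcriticalWeight.halfOp ∘L hv.isSubcriticalWeight.halfOp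

lemma inner_potentialOp (hv : IsBoundedWeight v C) (h k : Lp ℝ 2 (radialMeasure v)) :
    inner ℝ (hv.potentialOp h) k
      = inner ℝ (hv.isSubcriticalWeight.halfOp h) (hv.isSubcriticalWeight.halfOp k) := by
  rw [potentialOp, ContinuousLinearMap.comp_apply, ContinuousLinearMap.adjoint_inner_left]

/-- Test `S* S h` against every `k`: after Fubini, the factor `v` cancels the denominator of the
density `s / v`. -/
lemma potentialOp_eq (hv : IsBoundedWeight v C) (h : Lp ℝ 2 (radialMeasure v)) :
    hv.potentialOp h = (hv.memLp_mul_radialPotential h).toLp _ := by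
  refine ext_inner_right ℝ fun k => ?_
  rw [hv.inner_potentialOp, IsSubcriticalWeight.inner_halfOp,
    ← hv.integral_mul_radialPotential h (hv.integrable_mul k)]
  conv_rhs => rw [← Lp.toLp_coeFn k (Lp.memLp k)]
  rw [hv.inner_toLp]
  refine integral_congr_ae ?_
  filter_upwards [ae_unitVol_mem] with s hs
  have := (hv.pos s hs).ne'
  field_simp

lemma potentialOp_ae_eq (hv : IsBoundedWeight v C) (h : Lp ℝ 2 (radialMeasure v)) :
    hv.potentialOp h =ᵐ[radialMeasure v] fun r => v r * radialPotential h r := by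
  rw [hv.potentialOp_eq]
  exact MemLp.coeFn_toLp _

lemma isSelfAdjoint_potentialOp (hv : IsBoundedWeight v C) : IsSelfAdjoint hv.potentialOp := by
  rw [ContinuousLinearMap.isSelfAdjoint_iff_isSymmetric]
  intro h k
  change inner ℝ (hv.potentialOp h) k = inner ℝ h (hv.potentialOp k)
  rw [real_inner_comm (hv.potentialOp k) h, hv.inner_potentialOp, hv.inner_potentialOp,
    real_inner_comm]

lemma isCompactOperator_potentialOp (hv : IsBoundedWeight v C) :
    IsCompactOperator hv.potentialOp :=
  hv.isSubcriticalWeight.hilbertSchmidtSqLE_halfOp.isCompactOperator.clm_comp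
    (ContinuousLinearMap.adjoint hv.isSubcriticalWeight.halfOp)

lemma isHilbertSchmidt_potentialOp (hv : IsBoundedWeight v C) :
    IsHilbertSchmidt hv.potentialOp :=
  hv.isSubcriticalWeight.hilbertSchmidtSqLE_halfOp.isHilbertSchmidt _

/-- The primitive of `s h(s)` vanishes almost everywhere, hence everywhere by continuity, and
Lebesgue differentiation gives `s h(s) = 0`. -/
lemma eq_zero_of_halfOp_eq_zero (hv : IsBoundedWeight v C) {h : Lp ℝ 2 (radialMeasure v)}
    (h0 : hv.isSubcriticalWeight.halfOp h = 0) : h = 0 := by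
  rw [IsSubcriticalWeight.halfOp_apply, Lp.eq_zero_iff_ae_eq_zero] at h0
  replace h0 := (MemLp.coeFn_toLp _).symm.trans h0
  have hint := hv.intervalIntegrable_mul h
  have hP : (fun τ => ∫ s in (0 : ℝ)..τ, s * h s) =ᵐ[unitVol] fun _ => 0 := by
    filter_upwards [h0, ae_unitVol_mem] with τ h1 hτ
    rw [intervalIntegral_eq_Ioo hτ.1.le]
    have h2 : (√τ)⁻¹ ≠ 0 := inv_ne_zero (Real.sqrt_pos.2 hτ.1).ne'
    simpa [radialHalf, h2] using h1
  have hcont := intervalIntegral.continuousOn_primitive_interval' hint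
    (left_mem_uIcc (a := (0 : ℝ)) (b := 1))
  rw [uIcc_of_le zero_le_one] at hcont
  have hzero := Measure.eqOn_open_of_ae_eq hP isOpen_Ioo
    (hcont.mono Ioo_subset_Icc_self) continuousOn_const
  rw [Lp.eq_zero_iff_ae_eq_zero, Filter.EventuallyEq, hv.ae_eq]
  filter_upwards [ae_restrict_of_ae hint.ae_hasDerivAt_integral, ae_unitVol_mem] with x hx hxm
  have hx1 := hx (by rw [uIcc_of_le zero_le_one]; exact ⟨hxm.1.le, hxm.2.le⟩) 0
    (left_mem_uIcc)
  have hx2 : HasDerivAt (fun τ => ∫ s in (0 : ℝ)..τ, s * h s) 0 x :=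
    (hasDerivAt_const x (0 : ℝ)).congr_of_eventuallyEq
      (Filter.eventuallyEq_of_mem (isOpen_Ioo.mem_nhds hxm) hzero)
  have := hx1.unique hx2
  simpa [hxm.1.ne'] using this

lemma inner_potentialOp_pos (hv : IsBoundedWeight v C) {h : Lp ℝ 2 (radialMeasure v)}
    (hh : h ≠ 0) : 0 < inner ℝ (hv.potentialOp h) h := by
  rw [hv.inner_potentialOp, real_inner_self_eq_norm_sq]
  have : hv.isSubcriticalWeight.halfOp h ≠ 0 := fun h0 => hh (hv.eq_zero_of_halfOp_eq_zero h0)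
  positivity

/-- Since the potential operator is positive, `-1` is not one of its eigenvalues. -/
lemma eq_zero_of_ae_eq_neg (hv : IsBoundedWeight v C) {h : Lp ℝ 2 (radialMeasure v)}
    (hh : ∀ᵐ s ∂unitVol, v s * radialPotential h s = -h s) : h = 0 := by
  by_contra hne
  have hT : hv.potentialOp h = -h := by
    refine Lp.ext ?_
    rw [← hv.ae_eq] at hh
    filter_upwards [hv.potentialOp_ae_eq h, Lp.coeFn_neg h, hh] with s e1 e2 e3
    rw [e1, e2, e3, Pi.neg_apply]
  have hpos := hv.inner_potentialOp_pos hne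
  rw [hT, inner_neg_left, real_inner_self_eq_norm_sq] at hpos
  linarith [sq_nonneg ‖h‖]

end IsBoundedWeight

/-! ### Regularity and growth of the profile and its mean -/

variable {β : ℝ≥0} {f₀ : ℝ → ℝ}

lemma SmoothProfile.continuousOn (h : SmoothProfile β f₀) : ContinuousOn f₀ (Icc 0 1) := by
  obtain ⟨g, ⟨hg, -⟩, hf⟩ := h
  refine ContinuousOn.congr (f := fun r => g (r ^ 2)) ?_ hf
  refine hg.continuousOn.comp (by fun_prop) fun r hr => ?_
  exact ⟨by positivity, pow_le_one₀ hr.1 hr.2⟩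

/-- `f₀'(r) / r`, extended by its limit at `0`, is a continuous function on `[0,1]`. -/
lemma SmoothProfile.exists_hasDerivWithinAt (h : SmoothProfile β f₀) :
    ∃ w : ℝ → ℝ, ContinuousOn w (Icc 0 1) ∧
      (∀ r ∈ Icc (0 : ℝ) 1, HasDerivWithinAt f₀ (r * w r) (Icc 0 1) r) ∧
      ∀ r ∈ Icc (0 : ℝ) 1, derivOverR f₀ r = w r := by
  obtain ⟨g, ⟨hg, -⟩, hf⟩ := h
  have hmaps : MapsTo (fun r : ℝ => r ^ 2) (Icc 0 1) (Icc 0 1) := fun r hr =>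
    ⟨by positivity, pow_le_one₀ hr.1 hr.2⟩
  have hu : UniqueDiffOn ℝ (Icc (0 : ℝ) 1) := uniqueDiffOn_Icc zero_lt_one
  have hw : ContinuousOn (fun r => 2 * derivWithin g (Icc 0 1) (r ^ 2)) (Icc 0 1) :=
    continuousOn_const.mul
      ((hg.continuousOn_derivWithin hu (by norm_num)).comp (by fun_prop) hmaps)
  have hderiv : ∀ r ∈ Icc (0 : ℝ) 1,
      HasDerivWithinAt f₀ (r * (2 * derivWithin g (Icc 0 1) (r ^ 2))) (Icc 0 1) r := by
    intro r hr
    have h1 : HasDerivWithinAt g (derivWithin g (Icc 0 1) (r ^ 2)) (Icc 0 1) (r ^ 2) :=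
      ((hg.differentiableOn (by norm_num)) _ (hmaps hr)).hasDerivWithinAt
    have h2 : HasDerivWithinAt (fun r : ℝ => r ^ 2) (2 * r) (Icc 0 1) r := by
      simpa using (hasDerivAt_pow 2 r).hasDerivWithinAt
    have h3 := (HasDerivWithinAt.comp (h := fun r : ℝ => r ^ 2) r h1 h2 hmaps).congr (fun x hx => hf x hx) (hf r hr)
    have h4 : r * (2 * derivWithin g (Icc 0 1) (r ^ 2))
        = derivWithin g (Icc 0 1) (r ^ 2) * (2 * r) := by ring
    rw [h4]
    exact h3
  have hprof : ∀ r ∈ Icc (0 : ℝ) 1,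
      profileDeriv f₀ r = r * (2 * derivWithin g (Icc 0 1) (r ^ 2)) :=
    fun r hr => (hderiv r hr).derivWithin (hu r hr)
  refine ⟨_, hw, hderiv, fun r hr => ?_⟩
  have h0 : (0 : ℝ) ∈ Icc (0 : ℝ) 1 := ⟨le_rfl, zero_le_one⟩
  unfold derivOverR
  split_ifs with hr0
  · subst hr0
    refine HasDerivWithinAt.derivWithin ?_ (hu 0 h0)
    -- The difference quotient of `r * w r` at `0` is `w`, so continuity of `w` supplies the limit.
    rw [hasDerivWithinAt_iff_tendsto_slope]
    have h1 := ((hw 0 h0).mono_left (nhdsWithin_mono 0 (sdiff_subset (t := {0}))))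
    refine Filter.Tendsto.congr' ?_ h1
    filter_upwards [self_mem_nhdsWithin] with x hx
    have hx0 : x ≠ 0 := hx.2
    rw [slope_def_field, hprof x hx.1, hprof 0 h0]
    field_simp
    ring
  · rw [hprof r hr, mul_div_cancel_left₀ _ hr0]

lemma derivOverR_lower_bound (hS : SmoothProfile β f₀) (hM : MonotoneProfile f₀) :
    ∃ c > 0, ∀ r ∈ Icc (0 : ℝ) 1, c ≤ derivOverR f₀ r := by
  obtain ⟨w, hw, -, heq⟩ := hS.exists_hasDerivWithinAt
  -- A set unbounded below has `sInf` equal to `0` by convention, which the strict inequality in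
  -- `MonotoneProfile` excludes.
  have hbdd : BddBelow ((fun r => profileDeriv f₀ r / r) '' Ioc 0 1) := by
    by_contra hb
    have := Real.sInf_of_not_bddBelow hb
    rw [MonotoneProfile, this] at hM
    exact lt_irrefl _ hM
  refine ⟨_, hM, fun r hr => ?_⟩
  have hpos : ∀ r ∈ Ioc (0 : ℝ) 1,
      sInf ((fun r => profileDeriv f₀ r / r) '' Ioc 0 1) ≤ w r := by
    intro r hr
    rw [← heq r ⟨hr.1.le, hr.2⟩, derivOverR, if_neg hr.1.ne']
    exact csInf_le hbdd ⟨r, hr, rfl⟩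
  rw [heq r hr]
  have hcl : Icc (0 : ℝ) 1 ⊆ closure (Ioc 0 1) := by rw [closure_Ioc zero_ne_one]
  exact ContinuousWithinAt.closure_le (hcl hr) continuousWithinAt_const
    ((hw r hr).mono Ioc_subset_Icc_self) hpos

lemma continuousOn_derivOverR (hS : SmoothProfile β f₀) :
    ContinuousOn (derivOverR f₀) (Icc 0 1) := by
  obtain ⟨w, hw, -, heq⟩ := hS.exists_hasDerivWithinAt
  exact hw.congr heq

/-- Values of `f₀` outside `[0,1]` are arbitrary; the constant extension is continuous on `ℝ`, so
parametric integration applies. -/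
lemma meanProfile_eq_extend {r : ℝ} (hr : r ∈ Icc (0 : ℝ) 1) :
    meanProfile f₀ r
      = ∫ s in (0 : ℝ)..1, s * IccExtend (zero_le_one' ℝ) ((Icc 0 1).domRestrict f₀) (r * s) := by
  refine intervalIntegral.integral_congr fun s hs => ?_
  rw [uIcc_of_le zero_le_one] at hs
  have : r * s ∈ Icc (0 : ℝ) 1 := ⟨mul_nonneg hr.1 hs.1, mul_le_one₀ hr.2 hs.1 hs.2⟩
  simp only [IccExtend_of_mem _ _ this, domRestrict_apply]

lemma continuousOn_meanProfile (hS : SmoothProfile β f₀) :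
    ContinuousOn (meanProfile f₀) (Icc 0 1) := by
  have hc : Continuous (IccExtend (zero_le_one' ℝ) ((Icc 0 1).domRestrict f₀)) :=
    (continuousOn_iff_continuous_domRestrict.1 hS.continuousOn).Icc_extend'
  have h1 : Continuous fun r : ℝ =>
      ∫ s in (0 : ℝ)..1, s * IccExtend (zero_le_one' ℝ) ((Icc 0 1).domRestrict f₀) (r * s) :=
    intervalIntegral.continuous_parametric_intervalIntegral_of_continuous' (by fun_prop) 0 1
  exact h1.continuousOn.congr fun r hr => meanProfile_eq_extend hr

lemma kappa₁_le_meanProfile (hS : SmoothProfile β f₀) {r : ℝ} (hr : r ∈ Icc (0 : ℝ) 1) :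
    kappa₁ f₀ ≤ meanProfile f₀ r :=
  csInf_le (isCompact_Icc.image_of_continuousOn (continuousOn_meanProfile hS)).bddBelow
    (mem_image_of_mem _ hr)

lemma meanProfile_le_kappa₂ (hS : SmoothProfile β f₀) {r : ℝ} (hr : r ∈ Icc (0 : ℝ) 1) :
    meanProfile f₀ r ≤ kappa₂ f₀ :=
  le_csSup (isCompact_Icc.image_of_continuousOn (continuousOn_meanProfile hS)).bddAbove
    (mem_image_of_mem _ hr)

/-- The profile grows at least quadratically. -/
lemma profile_sub_ge (hS : SmoothProfile β f₀) {c : ℝ}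
    (hc : ∀ r ∈ Icc (0 : ℝ) 1, c ≤ derivOverR f₀ r) {x y : ℝ} (hx : 0 ≤ x) (hxy : x ≤ y)
    (hy : y ≤ 1) : c / 2 * (y ^ 2 - x ^ 2) ≤ f₀ y - f₀ x := by
  obtain ⟨w, hw, hd, heq⟩ := hS.exists_hasDerivWithinAt
  have hmono : MonotoneOn (fun r => f₀ r - c / 2 * r ^ 2) (Icc 0 1) := by
    refine monotoneOn_of_hasDerivWithinAt_nonneg (f' := fun r => r * w r - c / 2 * (2 * r))
      (convex_Icc 0 1) ?_ ?_ ?_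
    · exact hS.continuousOn.sub (by fun_prop)
    · intro r hr
      have hr' := interior_subset hr
      have h2 : HasDerivWithinAt (fun r : ℝ => c / 2 * r ^ 2) (c / 2 * (2 * r))
          (interior (Icc 0 1)) r := by
        simpa using ((hasDerivAt_pow 2 r).const_mul (c / 2)).hasDerivWithinAt
      exact ((hd r hr').mono interior_subset).sub h2
    · intro r hr
      have hr' := interior_subset hr
      have := hc r hr'
      rw [heq r hr'] at this
      nlinarith [hr'.1]
  have := hmono ⟨hx, hxy.trans hy⟩ ⟨hx.trans hxy, hy⟩ hxy
  simp only at this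
  linarith

/-- Compare with `r = 1`: quadratic growth gives `s (f₀ s - f₀ (r s)) ≥ c/2 (1 - r²) s³`. Since `∫₀¹
s³ = 1/4` and `1 - r² ≥ 1 - r`, the constant is `c/8`. -/
lemma kappa₂_sub_meanProfile_ge (hS : SmoothProfile β f₀) {c : ℝ} (hc0 : 0 < c)
    (hc : ∀ r ∈ Icc (0 : ℝ) 1, c ≤ derivOverR f₀ r) {r : ℝ} (hr : r ∈ Icc (0 : ℝ) 1) :
    c / 8 * (1 - r) ≤ kappa₂ f₀ - meanProfile f₀ r := by
  have h1 := meanProfile_le_kappa₂ hS (right_mem_Icc.2 (zero_le_one' ℝ))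
  have hi : ∀ r ∈ Icc (0 : ℝ) 1, IntervalIntegrable (fun s => s * f₀ (r * s)) volume 0 1 := by
    intro r hr
    refine ContinuousOn.intervalIntegrable ?_
    rw [uIcc_of_le zero_le_one]
    refine continuousOn_id.mul (hS.continuousOn.comp (by fun_prop) fun s hs => ?_)
    exact ⟨mul_nonneg hr.1 hs.1, mul_le_one₀ hr.2 hs.1 hs.2⟩
  have h2 : ∫ s in (0 : ℝ)..1, c / 2 * (1 - r ^ 2) * s ^ 3
      ≤ meanProfile f₀ 1 - meanProfile f₀ r := by
    rw [meanProfile, meanProfile, ← intervalIntegral.integral_sub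
      (hi 1 (right_mem_Icc.2 zero_le_one)) (hi r hr)]
    refine intervalIntegral.integral_mono_on zero_le_one
      (Continuous.intervalIntegrable (by fun_prop) _ _)
      ((hi 1 (right_mem_Icc.2 zero_le_one)).sub (hi r hr)) fun s hs => ?_
    have h3 := profile_sub_ge hS hc (mul_nonneg hr.1 hs.1)
      (mul_le_of_le_one_left hs.1 hr.2) hs.2
    rw [one_mul]
    nlinarith [mul_le_mul_of_nonneg_left h3 hs.1]
  rw [intervalIntegral.integral_const_mul, integral_pow] at h2
  norm_num at h2
  nlinarith [mul_nonneg hr.1 (sub_nonneg.2 hr.2)]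

/-! ### The weights `ν_Ω` and the kernel below `κ₁` -/

variable {Ω : ℝ}

lemma aemeasurable_unitVol_of_continuousOn {F : ℝ → ℝ} (hF : ContinuousOn F (Icc 0 1)) :
    AEMeasurable F unitVol :=
  (hF.mono Ioo_subset_Icc_self).aemeasurable measurableSet_Ioo

lemma mem_Icc_of_mem_Ioo {s : ℝ} (hs : s ∈ Ioo (0 : ℝ) 1) : s ∈ Icc (0 : ℝ) 1 :=
  Ioo_subset_Icc_self hs

lemma exists_gap_meanProfile (hS : SmoothProfile β f₀)
    (hΩ : Ω ∉ Icc (kappa₁ f₀) (kappa₂ f₀)) :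
    ∃ δ > 0, ∀ r ∈ Icc (0 : ℝ) 1, δ ≤ |Ω - meanProfile f₀ r| := by
  by_cases h : Ω < kappa₁ f₀
  · refine ⟨kappa₁ f₀ - Ω, sub_pos.2 h, fun r hr => ?_⟩
    rw [abs_sub_comm]
    exact le_trans (by linarith [kappa₁_le_meanProfile hS hr]) (le_abs_self _)
  · have h2 : kappa₂ f₀ < Ω := not_le.1 fun hle => hΩ ⟨not_lt.1 h, hle⟩
    refine ⟨Ω - kappa₂ f₀, sub_pos.2 h2, fun r hr => ?_⟩
    exact le_trans (by linarith [meanProfile_le_kappa₂ hS hr]) (le_abs_self _)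

lemma exists_isBoundedWeight_nu (hS : SmoothProfile β f₀) (hM : MonotoneProfile f₀)
    (hΩ : Ω ∉ Icc (kappa₁ f₀) (kappa₂ f₀)) : ∃ C, IsBoundedWeight (nu f₀ Ω) C := by
  obtain ⟨δ, hδ, hgap⟩ := exists_gap_meanProfile hS hΩ
  obtain ⟨c, hc, hlow⟩ := derivOverR_lower_bound hS hM
  have hne : ∀ r ∈ Icc (0 : ℝ) 1, Ω - meanProfile f₀ r ≠ 0 := fun r hr h0 => by
    have := hgap r hr
    rw [h0, abs_zero] at this
    linarith
  have hcont : ContinuousOn (nu f₀ Ω) (Icc 0 1) :=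
    ((continuousOn_derivOverR hS).div
      (continuousOn_const.sub (continuousOn_meanProfile hS)) hne).abs
  obtain ⟨C, hC⟩ := isCompact_Icc.exists_bound_of_continuousOn hcont
  refine ⟨C, ⟨⟨aemeasurable_unitVol_of_continuousOn hcont, fun s hs => ?_⟩, fun s hs => ?_⟩⟩
  · have hs' := mem_Icc_of_mem_Ioo hs
    exact abs_pos.2 (div_ne_zero (hc.trans_le (hlow s hs')).ne' (hne s hs'))
  · exact (le_abs_self _).trans (hC s (mem_Icc_of_mem_Ioo hs))

lemma zero_mem_kerL₀ (hS : SmoothProfile β f₀) (hM : MonotoneProfile f₀)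
    (hΩ : Ω ∉ Icc (kappa₁ f₀) (kappa₂ f₀)) : (0 : L2 f₀ Ω) ∈ kerL₀ f₀ Ω := by
  obtain ⟨C, hv⟩ := exists_isBoundedWeight_nu hS hM hΩ
  change ∀ᵐ r ∂radialMeasure (nu f₀ Ω), bbL₀ f₀ Ω (0 : Lp ℝ 2 (radialMeasure (nu f₀ Ω))) r = 0
  have h1 := hv.potentialOp_ae_eq 0
  rw [map_zero] at h1
  have hmem : ∀ᵐ r ∂radialMeasure (nu f₀ Ω), r ∈ Ioo (0 : ℝ) 1 := by
    rw [hv.ae_eq]; exact ae_unitVol_mem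
  filter_upwards [h1, Lp.coeFn_zero ℝ 2 (radialMeasure (nu f₀ Ω)), hmem] with r h2 h3 hr
  rw [h3, Pi.zero_apply] at h2
  rw [bbL₀, h3, (mul_eq_zero.1 h2.symm).resolve_left (hv.pos r hr).ne']
  simp

lemma ae_eq_of_mem_kerL₀ {C : ℝ} (hv : IsBoundedWeight (nu f₀ Ω) C) {h : L2 f₀ Ω}
    (hh : h ∈ kerL₀ f₀ Ω) :
    ∀ᵐ s ∂unitVol, h s / mu f₀ Ω s = radialPotential h s := by
  have h1 : ∀ᵐ s ∂radialMeasure (nu f₀ Ω), bbL₀ f₀ Ω h s = 0 := hh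
  rw [hv.ae_eq] at h1
  filter_upwards [h1] with s hs
  exact sub_eq_zero.1 hs

/-- Below the spectrum the kernel is trivial, by positivity of the potential operator. -/
lemma kerL₀_eq_of_lt (hS : SmoothProfile β f₀) (hM : MonotoneProfile f₀)
    (hΩ : Ω < kappa₁ f₀) : kerL₀ f₀ Ω = {0} := by
  have hΩ' : Ω ∉ Icc (kappa₁ f₀) (kappa₂ f₀) := fun h => absurd h.1 (not_le.2 hΩ)
  obtain ⟨C, hv⟩ := exists_isBoundedWeight_nu hS hM hΩ'
  obtain ⟨c, hc, hlow⟩ := derivOverR_lower_bound hS hM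
  refine subset_antisymm (fun h hh => ?_)
    (singleton_subset_iff.2 (zero_mem_kerL₀ hS hM hΩ'))
  refine hv.eq_zero_of_ae_eq_neg (h := h) ?_
  filter_upwards [ae_eq_of_mem_kerL₀ hv hh, ae_unitVol_mem] with s e hs
  have hs' := mem_Icc_of_mem_Ioo hs
  have hmu : mu f₀ Ω s < 0 := div_neg_of_pos_of_neg (hc.trans_le (hlow s hs'))
    (by linarith [kappa₁_le_meanProfile hS hs'])
  -- Here `μ = -ν`, so the kernel equation becomes `ν K h = -h`.
  have h1 : nu f₀ Ω s * radialPotential h s = -h s := by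
    rw [← e, nu, abs_of_neg hmu, neg_mul, mul_div_cancel₀ _ hmu.ne]
  exact h1

/-! ### The threshold weight and finiteness above `κ₂` -/

lemma radialMeasure_le_smul {u v : ℝ → ℝ} {c : ℝ} (hc : 0 ≤ c)
    (h : ∀ s ∈ Ioo (0 : ℝ) 1, s / v s ≤ c * (s / u s)) :
    radialMeasure v ≤ ENNReal.ofReal c • radialMeasure u := by
  rw [radialMeasure_eq, radialMeasure_eq, ← withDensity_smul' _ _ ENNReal.ofReal_ne_top]
  refine withDensity_mono ?_
  filter_upwards [ae_unitVol_mem] with s hs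
  rw [Pi.smul_apply, smul_eq_mul, ← ENNReal.ofReal_mul hc]
  exact ENNReal.ofReal_le_ofReal (h s hs)

lemma isRadialWeight_derivOverR (hS : SmoothProfile β f₀) (hM : MonotoneProfile f₀) :
    IsRadialWeight (derivOverR f₀) := by
  obtain ⟨c, hc, hlow⟩ := derivOverR_lower_bound hS hM
  exact ⟨aemeasurable_unitVol_of_continuousOn (continuousOn_derivOverR hS),
    fun s hs => hc.trans_le (hlow s (mem_Icc_of_mem_Ioo hs))⟩

/-- At the threshold `Ω = κ₂` the weight `μ_Ω` has at most a simple pole at the boundary. -/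
lemma exists_isSubcriticalWeight (hS : SmoothProfile β f₀) (hM : MonotoneProfile f₀) :
    ∃ C, IsSubcriticalWeight (mu f₀ (kappa₂ f₀)) C := by
  obtain ⟨c, hc, hlow⟩ := derivOverR_lower_bound hS hM
  obtain ⟨W, hW⟩ := isCompact_Icc.exists_bound_of_continuousOn (continuousOn_derivOverR hS)
  have hgap : ∀ s ∈ Ioo (0 : ℝ) 1, 0 < c / 8 * (1 - s) := fun s hs =>
    mul_pos (by positivity) (by linarith [hs.2])
  refine ⟨W / (c / 8), ⟨⟨?_, fun s hs => ?_⟩, fun s hs => ?_⟩⟩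
  · exact (aemeasurable_unitVol_of_continuousOn (continuousOn_derivOverR hS)).div
      (aemeasurable_const.sub (aemeasurable_unitVol_of_continuousOn (continuousOn_meanProfile hS)))
  · have hs' := mem_Icc_of_mem_Ioo hs
    exact div_pos (hc.trans_le (hlow s hs'))
      ((hgap s hs).trans_le (kappa₂_sub_meanProfile_ge hS hc hlow hs'))
  · have hs' := mem_Icc_of_mem_Ioo hs
    have h1 : derivOverR f₀ s ≤ W := (le_abs_self _).trans (hW s hs')
    have h2 : 0 ≤ W := (hc.le.trans (hlow s hs')).trans h1
    rw [div_div]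
    exact div_le_div₀ h2 h1 (hgap s hs) (kappa₂_sub_meanProfile_ge hS hc hlow hs')

lemma notMem_Icc_of_kappa₂_lt (hΩ : kappa₂ f₀ < Ω) : Ω ∉ Icc (kappa₁ f₀) (kappa₂ f₀) :=
  fun h => absurd h.2 (not_le.2 hΩ)

lemma nu_eq_mu (hS : SmoothProfile β f₀) (hM : MonotoneProfile f₀) (hΩ : kappa₂ f₀ < Ω) {s : ℝ}
    (hs : s ∈ Icc (0 : ℝ) 1) : nu f₀ Ω s = mu f₀ Ω s := by
  obtain ⟨c, hc, hlow⟩ := derivOverR_lower_bound hS hM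
  exact abs_of_pos (div_pos (hc.trans_le (hlow s hs))
    (by linarith [meanProfile_le_kappa₂ hS hs]))

/-- Lowering `Ω` to `κ₂` shrinks `Ω - meanProfile f₀ s`, hence the density. All kernel elements
thereby enter one common space. -/
lemma memLp_mu_kappa₂ (hS : SmoothProfile β f₀) (hM : MonotoneProfile f₀)
    (hΩ : kappa₂ f₀ < Ω) (h : L2 f₀ Ω) : MemLp h 2 (radialMeasure (mu f₀ (kappa₂ f₀))) := by
  refine (Lp.memLp h).of_measure_le_smul (c := ENNReal.ofReal 1) ENNReal.ofReal_ne_top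
    (radialMeasure_le_smul zero_le_one fun s hs => ?_)
  have hs' := mem_Icc_of_mem_Ioo hs
  have hw := (isRadialWeight_derivOverR hS hM).pos s hs
  rw [nu_eq_mu hS hM hΩ hs', one_mul, mu, mu, div_div_eq_mul_div, div_div_eq_mul_div]
  have := hs.1.le
  gcongr

/-- The gap `Ω - meanProfile f₀ s` is at least `Ω - κ₂`, whence the constant `(Ω - κ₂)⁻¹`. -/
lemma memLp_derivOverR (hS : SmoothProfile β f₀) (hM : MonotoneProfile f₀)
    (hΩ : kappa₂ f₀ < Ω) (h : L2 f₀ Ω) : MemLp h 2 (radialMeasure (derivOverR f₀)) := by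
  have hpos := sub_pos.2 hΩ
  refine (Lp.memLp h).of_measure_le_smul (c := ENNReal.ofReal (Ω - kappa₂ f₀)⁻¹)
    ENNReal.ofReal_ne_top (radialMeasure_le_smul (inv_nonneg.2 hpos.le) fun s hs => ?_)
  have hs' := mem_Icc_of_mem_Ioo hs
  have hw := (isRadialWeight_derivOverR hS hM).pos s hs
  rw [nu_eq_mu hS hM hΩ hs', mu, div_div_eq_mul_div, ← mul_div_assoc]
  gcongr
  rw [le_inv_mul_iff₀ hpos, mul_comm]
  have := meanProfile_le_kappa₂ hS hs'
  have := hs.1.le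
  gcongr

/-- The quadratic form of the potential on kernel elements for different values of `Ω`. -/
lemma inner_halfOp_of_mem_kerL₀ (hS : SmoothProfile β f₀) (hM : MonotoneProfile f₀) {C : ℝ}
    (hv : IsSubcriticalWeight (mu f₀ (kappa₂ f₀)) C) {Ω' : ℝ} (hΩ : kappa₂ f₀ < Ω)
    (hΩ' : kappa₂ f₀ < Ω') {h : L2 f₀ Ω} (hh : h ∈ kerL₀ f₀ Ω) (k : L2 f₀ Ω') :
    inner ℝ (hv.halfOp ((memLp_mu_kappa₂ hS hM hΩ h).toLp h))
        (hv.halfOp ((memLp_mu_kappa₂ hS hM hΩ' k).toLp k))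
      = (Ω - kappa₂ f₀) * inner ℝ ((memLp_derivOverR hS hM hΩ h).toLp h)
          ((memLp_derivOverR hS hM hΩ' k).toLp k)
        + inner ℝ ((memLp_mu_kappa₂ hS hM hΩ h).toLp h)
          ((memLp_mu_kappa₂ hS hM hΩ' k).toLp k) := by
  have hw := isRadialWeight_derivOverR hS hM
  obtain ⟨D, hvΩ⟩ := exists_isBoundedWeight_nu hS hM (notMem_Icc_of_kappa₂_lt hΩ)
  obtain ⟨D', hvΩ'⟩ := exists_isBoundedWeight_nu hS hM (notMem_Icc_of_kappa₂_lt hΩ')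
  have e1 : (memLp_mu_kappa₂ hS hM hΩ h).toLp h =ᵐ[unitVol] h := by
    rw [← hv.ae_eq]; exact MemLp.coeFn_toLp _
  have e2 : (memLp_mu_kappa₂ hS hM hΩ' k).toLp k =ᵐ[unitVol] k := by
    rw [← hv.ae_eq]; exact MemLp.coeFn_toLp _
  have i1 := (memLp_derivOverR hS hM hΩ h).integrable_mul (memLp_derivOverR hS hM hΩ' k)
  have i2 := (memLp_mu_kappa₂ hS hM hΩ h).integrable_mul (memLp_mu_kappa₂ hS hM hΩ' k)
  rw [hw.integrable_iff] at i1
  rw [hv.integrable_iff] at i2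
  rw [hv.inner_halfOp, hw.inner_toLp, hv.inner_toLp, ← integral_const_mul]
  calc ∫ τ, radialHalf ((memLp_mu_kappa₂ hS hM hΩ h).toLp h) τ
        * radialHalf ((memLp_mu_kappa₂ hS hM hΩ' k).toLp k) τ ∂unitVol
      = ∫ τ, radialHalf h τ * radialHalf k τ ∂unitVol := by
        refine integral_congr_ae ?_
        filter_upwards [ae_unitVol_mem] with τ hτ
        rw [radialHalf_congr e1 hτ.2.le, radialHalf_congr e2 hτ.2.le]
    _ = ∫ s, s * k s * radialPotential h s ∂unitVol :=
        (hvΩ.integral_mul_radialPotential h (hvΩ'.integrable_mul k)).symm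
    -- The kernel equation replaces the potential by `h / μ_Ω`, and `Ω - m = (Ω - κ₂) + (κ₂ - m)`
    -- splits `1/μ_Ω`, with `m` the mean profile.
    _ = ∫ s, ((Ω - kappa₂ f₀) * (s / derivOverR f₀ s * (h s * k s))
          + s / mu f₀ (kappa₂ f₀) s * (h s * k s)) ∂unitVol := by
        refine integral_congr_ae ?_
        filter_upwards [ae_eq_of_mem_kerL₀ hvΩ hh, ae_unitVol_mem] with s hs hsm
        have hne := (hw.pos s hsm).ne'
        rw [← hs, mu, mu, div_div_eq_mul_div, div_div_eq_mul_div]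
        field_simp
        ring
    _ = _ := integral_add (i1.const_mul _) i2

/-- Above the spectrum the kernel is trivial except for finitely many values of `Ω`. -/
lemma finite_setOf_kerL₀_ne (hS : SmoothProfile β f₀) (hM : MonotoneProfile f₀) :
    {Ω | kappa₂ f₀ < Ω ∧ kerL₀ f₀ Ω ≠ {0}}.Finite := by
  have hw := isRadialWeight_derivOverR hS hM
  obtain ⟨C, hv⟩ := exists_isSubcriticalWeight hS hM
  have hex : ∀ Ω : {Ω | kappa₂ f₀ < Ω ∧ kerL₀ f₀ Ω ≠ {0}}, ∃ h ∈ kerL₀ f₀ Ω.1, h ≠ 0 := by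
    rintro ⟨Ω, hΩ, hker⟩
    by_contra! hcon
    exact hker (subset_antisymm (fun h hh => hcon h hh)
      (singleton_subset_iff.2 (zero_mem_kerL₀ hS hM (notMem_Icc_of_kappa₂_lt hΩ))))
  choose h hker hne using hex
  have hlt : ∀ Ω : {Ω | kappa₂ f₀ < Ω ∧ kerL₀ f₀ Ω ≠ {0}}, kappa₂ f₀ < Ω.1 := fun Ω => Ω.2.1
  let x := fun Ω => (memLp_mu_kappa₂ hS hM (hlt Ω) (h Ω)).toLp (h Ω)
  let y := fun Ω => (memLp_derivOverR hS hM (hlt Ω) (h Ω)).toLp (h Ω)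
  have hform : ∀ Ω Ω', inner ℝ (hv.halfOp (x Ω)) (hv.halfOp (x Ω'))
      = (Ω.1 - kappa₂ f₀) * inner ℝ (y Ω) (y Ω') + inner ℝ (x Ω) (x Ω') := fun Ω Ω' =>
    inner_halfOp_of_mem_kerL₀ hS hM hv (hlt Ω) (hlt Ω') (hker Ω) (h Ω')
  -- Exchanging the two kernel elements changes only the coefficient `Ω - κ₂`; subtracting leaves
  -- `(Ω - Ω')⟨y, y'⟩ = 0`.
  have horth : ∀ Ω Ω', Ω ≠ Ω' → inner ℝ (y Ω) (y Ω') = 0 := by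
    intro Ω Ω' hdiff
    have h1 := hform Ω Ω'
    have h2 := hform Ω' Ω
    rw [real_inner_comm, real_inner_comm (y Ω), real_inner_comm (x Ω)] at h2
    have h3 : (Ω.1 - Ω'.1) * inner ℝ (y Ω) (y Ω') = 0 := by linarith
    exact (mul_eq_zero.1 h3).resolve_left (sub_ne_zero.2 (Subtype.coe_injective.ne hdiff))
  have hy : ∀ Ω, y Ω ≠ 0 := by
    intro Ω h0
    obtain ⟨D, hvΩ⟩ := exists_isBoundedWeight_nu hS hM (notMem_Icc_of_kappa₂_lt (hlt Ω))
    refine hne Ω (Lp.eq_zero_iff_ae_eq_zero.2 ?_)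
    have h1 := (MemLp.coeFn_toLp (memLp_derivOverR hS hM (hlt Ω) (h Ω))).symm.trans
      (Lp.eq_zero_iff_ae_eq_zero.1 h0)
    rw [Filter.EventuallyEq, hw.ae_eq, ← hvΩ.ae_eq] at h1
    exact h1
  by_contra hinf
  -- Choosing more values of `Ω` than the squared Hilbert–Schmidt bound contradicts the counting
  -- lemma.
  obtain ⟨n, hn⟩ := exists_nat_gt (∫ τ, C * -Real.log (1 - τ) ∂unitVol)
  obtain ⟨t, hts, htn⟩ := Set.Infinite.exists_subset_card_eq hinf n
  have hcard := hv.hilbertSchmidtSqLE_halfOp.card_le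
    (fun Ω : t => x ⟨Ω.1, hts Ω.2⟩)
    (fun Ω : t => (Ω.1 - kappa₂ f₀) * ‖y ⟨Ω.1, hts Ω.2⟩‖ ^ 2)
    (fun Ω => mul_pos (sub_pos.2 (hlt ⟨Ω.1, hts Ω.2⟩))
      (pow_pos (norm_pos_iff.2 (hy _)) 2))
    (fun Ω => by rw [hform, real_inner_self_eq_norm_sq (y _)])
    (fun Ω Ω' hdiff => by
      rw [hform, horth _ _ (fun he => hdiff (Subtype.ext (Subtype.mk.inj he))), mul_zero,
        zero_add])
  rw [Fintype.card_coe, htn] at hcard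
  linarith

end RadialVortex

end

open RadialVortex
theorem proposition4p2 (β : NNReal) (hβ0 : 0 < β) (hβ1 : β < 1) (f₀ : ℝ → ℝ)
    (hH1 : SmoothProfile β f₀) (hH2 : MonotoneProfile f₀) :
    (∀ Ω : ℝ, Ω ∉ Set.Icc (kappa₁ f₀) (kappa₂ f₀) →
      (∀ h : L2 f₀ Ω,
        IntervalIntegrable (fun s => s * h s) MeasureTheory.volume 0 1 ∧
        IntervalIntegrable (radialAverage h) MeasureTheory.volume 0 1) ∧
      ∃ T : L2 f₀ Ω →L[ℝ] L2 f₀ Ω,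
        (∀ h : L2 f₀ Ω, T h =ᵐ[lam f₀ Ω] calL₀ f₀ Ω h) ∧
        IsSelfAdjoint T ∧
        (∀ h : L2 f₀ Ω, h ≠ 0 → 0 < inner ℝ (T h) h) ∧
        IsCompactOperator T ∧
        IsHilbertSchmidt T) ∧
    (∀ Ω : ℝ, Ω < kappa₁ f₀ → kerL₀ f₀ Ω = {0}) ∧
    (∃ S : Set ℝ, S.Finite ∧ S ⊆ Set.Ioi (kappa₂ f₀) ∧
      ∀ Ω ∈ Set.Ioi (kappa₂ f₀) \ S, kerL₀ f₀ Ω = {0}) := by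
  refine ⟨fun Ω hΩ => ?_, fun Ω hΩ => kerL₀_eq_of_lt hH1 hH2 hΩ,
    {Ω | kappa₂ f₀ < Ω ∧ kerL₀ f₀ Ω ≠ {0}}, finite_setOf_kerL₀_ne hH1 hH2, fun Ω hΩ => hΩ.1,
    fun Ω hΩ => ?_⟩
  · obtain ⟨C, hv⟩ := exists_isBoundedWeight_nu hH1 hH2 hΩ
    exact ⟨fun h => ⟨hv.intervalIntegrable_mul h, hv.intervalIntegrable_radialAverage h⟩,
      hv.potentialOp, fun h => hv.potentialOp_ae_eq h, hv.isSelfAdjoint_potentialOp,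
      fun h hh => hv.inner_potentialOp_pos hh, hv.isCompactOperator_potentialOp,
      hv.isHilbertSchmidt_potentialOp⟩
  · by_contra hne
    exact hΩ.2 ⟨hΩ.1, hne⟩
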